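/- Let $s,t$ be integers with $|s|\ge 3$, $t\ge 1$ and $\gcd(s,t)=1$. With $p$ running over prime numbers, put \[ \alpha=\prod_{p\mid s}p^{1/(p-1)},\qquad \beta=\#\{p\ne 2 : p\mid s\},\qquad \gamma=\prod_{p\mid s,\ p\neq 2}p,\qquad \sigma=\frac{4t\alpha}{es^2}, \] \[ \rho=\begin{cases}7/3,&\sigma\ge 1,\\ 5-2\log\sigma,&\sigma<1,\end{cases}\qquad \eta=\max\left\{\frac{\sqrt e\,|e^{s/t}-1|\,\gamma}{\sqrt2\,\sigma^{\beta}}-\frac12,\ \frac e\sigma+\beta\right\},\qquad \varepsilon(N)=\frac{\log\log\log N}{\log\log N}. \] Let the real numbers $N_1,N_2>0$ be given by \[ \log N_1=\max\left\{(\eta-\beta)\log\bigl(\sigma(\eta-\beta)\bigr),\ \log\left(\frac{\gcd(2,s)}{|4s+2(s-2t)(e^{s/t}-1)|}\right)\right\}, \] \[ \log N_2=\max\left\{\log N_1,\ e^{4e},\ \sigma^{-2},\ \beta^2,\ \left(\frac{\rho(2\beta+1)}{2\log(|s|/\alpha)}\right)^{4/3}\right\}, \] and put \[ d=\left(\frac{(\log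 N_2)^{1/4}}{\sigma}+\beta\right)^{-1}, \] \[ c_2=\frac{8\gamma^2|s|^{2\beta+1}(1+d)^{\beta}\bigl(4t+d(6t+s^2)\bigr)}{\alpha^{2\beta+1}}+\frac{\gcd(2,s)\,\gamma\, s^{2(\beta-1)}\,d\,(d+d^2)^{\beta}}{N_2^2\,\alpha^{2(\beta-1)}\,|e^{s/t}-1|}. \] Then for all integers $M\neq 0$ and all integers $N\ge N_2$, \[ 1<\left|e^{s/t}-\frac MN\right|\,c_2\,N^{2+2\log(|s|/\alpha)\,(1+\rho\,\varepsilon(N))/\log\log N}\left(\frac{\log N}{\log\log N}\right)^{2\beta+1}. \] -/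

import Mathlib

namespace ExpApprox

noncomputable section

/-- `α = ∏_{p ∣ s} p^(1/(p-1))`, over the primes dividing `s` (including `2`). -/
def alpha (s : ℤ) : ℝ :=
  ∏ p ∈ s.natAbs.primeFactors, (p : ℝ) ^ (1 / ((p : ℝ) - 1))

/-- `β` is the number of odd primes dividing `s`. -/
def beta (s : ℤ) : ℕ := (s.natAbs.primeFactors.erase 2).card

/-- `γ` is the product of the odd primes dividing `s`. -/
def gamma (s : ℤ) : ℝ := ∏ p ∈ s.natAbs.primeFactors.erase 2, (p : ℝ)

/-- `σ = 4tα / (e s²)`. -/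
def sigma (s t : ℤ) : ℝ := 4 * t * alpha s / (Real.exp 1 * (s : ℝ) ^ 2)

/-- `ρ = 7/3` if `σ ≥ 1`, and `ρ = 5 - 2 log σ` if `σ < 1`. -/
def rho (s t : ℤ) : ℝ :=
  open Classical in if 1 ≤ sigma s t then 7 / 3 else 5 - 2 * Real.log (sigma s t)

/-- `η = max {√e |e^(s/t) - 1| γ / (√2 σ^β) - 1/2, e/σ + β}`. -/
def eta (s t : ℤ) : ℝ :=
  max (Real.sqrt (Real.exp 1) * |Real.exp (s / t) - 1| * gamma s
        / (Real.sqrt 2 * sigma s t ^ beta s) - 1 / 2)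
      (Real.exp 1 / sigma s t + beta s)

/-- `ε(N) = log log log N / log log N`. -/
def eps (N : ℝ) : ℝ :=
  Real.log (Real.log (Real.log N)) / Real.log (Real.log N)

/-- The logarithm of `N₁`. -/
def logN1 (s t : ℤ) : ℝ :=
  max ((eta s t - beta s) * Real.log (sigma s t * (eta s t - beta s)))
      (Real.log ((Int.gcd 2 s : ℝ)
        / |4 * (s : ℝ) + 2 * ((s : ℝ) - 2 * t) * (Real.exp (s / t) - 1)|))

/-- The logarithm of `N₂`: the maximum of
`log N₁`, `e^(4e)`, `σ⁻²`, `β²` and `(ρ(2β+1) / (2 log(|s|/α)))^(4/3)`. -/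
def logN2 (s t : ℤ) : ℝ :=
  max (logN1 s t) (max (Real.exp (4 * Real.exp 1)) (max ((sigma s t ^ 2)⁻¹)
    (max ((beta s : ℝ) ^ 2)
      ((rho s t * (2 * beta s + 1) / (2 * Real.log (|(s : ℝ)| / alpha s))) ^ (4 / 3 : ℝ)))))

/-- The real number `N₂`. -/
def N2 (s t : ℤ) : ℝ := Real.exp (logN2 s t)

/-- `d = ((log N₂)^(1/4) / σ + β)⁻¹`. -/
def d (s t : ℤ) : ℝ := (logN2 s t ^ (1 / 4 : ℝ) / sigma s t + beta s)⁻¹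

/-- The constant `c₂`; the exponents `2(β-1)` are integers, equal to `-2` if `β = 0`. -/
def c2 (s t : ℤ) : ℝ :=
  8 * gamma s ^ 2 * |(s : ℝ)| ^ (2 * beta s + 1) * (1 + d s t) ^ beta s
      * (4 * t + d s t * (6 * t + (s : ℝ) ^ 2))
      / alpha s ^ (2 * beta s + 1)
    + (Int.gcd 2 s : ℝ) * gamma s * (s : ℝ) ^ (2 * ((beta s : ℤ) - 1)) * d s t
      * (d s t + d s t ^ 2) ^ beta s
      / (N2 s t ^ 2 * alpha s ^ (2 * ((beta s : ℤ) - 1)) * |Real.exp (s / t) - 1|)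

end

end ExpApprox

/-!
Put `z = s / t`. The diagonal Padé approximants of `exp` at `z`, cleared of powers of `t`, are
`p n / q n` with `p n = bessel n s t` and `q n = bessel n (-s) t`, where `bessel` is the homogeneous
reverse Bessel polynomial. Both sequences and the remainder `r n = q n * exp z - p n` satisfy
`X (n + 2) = (4 n + 6) t X (n + 1) + s ^ 2 X n`. Hermite's integral for `r n` (`padeRemainder_eq`)
shows that the remainders alternate in sign, so the Casoratian of `r` with a positive solution of the
recurrence has two terms of the same sign and bounds each of them. This gives, up to the factor
`exp |z|`, the bound `2 |s| ^ (2 n + 1)` for `|q (n + 1) * r n|`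
(`bessel_abs_mul_abs_padeRemainder_le`), and an explicit upper bound for `|r n|`
(`abs_padeRemainder_le`).

The integers `p n` and `q n` have a large common factor `G n`: the exact power in `n!` of each odd prime
dividing `s`, and `2 ^ n` at the prime `2` if `s` is even (`commonFactor_dvd_bessel`). By Legendre's formula
`α ^ n ≤ γ n ^ β G n` (`alpha_pow_le`).

Let `m` be the last index with `2 N |r m| ≥ G m`. For one of `k = m + 1, m + 2` the integer
`(q k * M - p k * N) / G k` is nonzero, whence `G k < 2 N |exp z - M / N| |q k|`. Multiplied by
`G m ≤ 2 N |r m|`, this bounds `|exp z - M / N|` below in terms of `m`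
(`one_lt_of_last_large_remainder`). On the other hand the upper bound for `|r m|` and Stirling's
formula give `(m - β) log (σ (m - β)) ≤ log N` (`sub_beta_mul_log_le`), so `m - β` is at most about
`log N / log log N * (1 + c ε(N))` with `c < ρ`. The remaining gap between `c` and `ρ` absorbs the
factor `exp |z|` and the passage from `m` to `log N / log log N` in the factor `m ^ (2 β + 1)`
(`exponent_le`). The first summand of `c₂` already suffices; the second is nonnegative.
-/

namespace ExpApprox

section Arithmetic

open Finset Nat

/-! ### Reverse Bessel polynomials -/

/-- The coefficient `(n + i)! / (i! (n - i)!)` of the Bessel polynomial, written as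
`choose (n + i) (2 i) * ((2 i)! / i!)` so that it vanishes for `i > n`. -/
def besselCoeff (n i : ℕ) : ℕ := (n + i).choose (2 * i) * (i ! * i.centralBinom)

/-- The homogeneous reverse Bessel polynomial `∑ i ≤ n, (n + i)! / (i! (n - i)!) t ^ i x ^ (n - i)`.
At `x = s` and `x = -s` it is `t ^ n` times the numerator and the denominator of the diagonal Padé
approximant of `exp` at `s / t`. -/
def bessel {R : Type*} [CommRing R] (n : ℕ) (x t : R) : R :=
  ∑ i ∈ range (n + 1), (besselCoeff n i : R) * t ^ i * x ^ (n - i)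

lemma besselCoeff_zero_right (n : ℕ) : besselCoeff n 0 = 1 := by simp [besselCoeff]

lemma besselCoeff_eq_zero {n i : ℕ} (h : n < i) : besselCoeff n i = 0 := by
  simp [besselCoeff, Nat.choose_eq_zero_of_lt (show n + i < 2 * i by omega)]

lemma besselCoeff_succ_succ (n i : ℕ) :
    besselCoeff (n + 2) (i + 1) = (4 * n + 6) * besselCoeff (n + 1) i + besselCoeff n (i + 1) := by
  have hc : (i + 1) * (i + 1).centralBinom = 2 * (2 * i + 1) * i.centralBinom :=
    Nat.succ_mul_centralBinom_succ i
  have hp : (n + 1 + i + 2).choose (2 * i + 2) = (n + 1 + i).choose (2 * i) +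
      2 * (n + 1 + i).choose (2 * i + 1) + (n + 1 + i).choose (2 * i + 2) := by
    rw [Nat.choose_succ_succ, Nat.choose_succ_succ, Nat.choose_succ_succ]; ring
  have hk : (n + 1 + i).choose (2 * i + 1) * (2 * i + 1) + 2 * i * (n + 1 + i).choose (2 * i)
      = (n + 1 + i).choose (2 * i) * (n + 1 + i) := by
    rcases le_or_gt (2 * i) (n + 1 + i) with h | h
    · rw [Nat.choose_succ_right_eq]
      obtain ⟨m, hm⟩ := Nat.exists_eq_add_of_le h
      rw [hm]; simp; ring
    · simp [Nat.choose_eq_zero_of_lt h, Nat.choose_eq_zero_of_lt (show n + 1 + i < 2 * i + 1 by omega)]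
  have hf : (i + 1)! * (i + 1).centralBinom = 2 * (2 * i + 1) * (i ! * i.centralBinom) := by
    rw [Nat.factorial_succ]
    calc (i + 1) * i ! * (i + 1).centralBinom = i ! * ((i + 1) * (i + 1).centralBinom) := by ring
      _ = _ := by rw [hc]; ring
  unfold besselCoeff
  rw [show n + 2 + (i + 1) = n + 1 + i + 2 by ring, show 2 * (i + 1) = 2 * i + 2 by ring,
    show n + (i + 1) = n + 1 + i by ring, hp, hf]
  zify at hk ⊢
  linear_combination (4 * (i ! : ℤ) * i.centralBinom) * hk

lemma bessel_zero {R : Type*} [CommRing R] (x t : R) : bessel 0 x t = 1 := by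
  simp [bessel, besselCoeff]

lemma bessel_one {R : Type*} [CommRing R] (x t : R) : bessel 1 x t = 2 * t + x := by
  simp [bessel, besselCoeff, Finset.sum_range_succ, Nat.centralBinom]; ring

lemma bessel_add_two {R : Type*} [CommRing R] (n : ℕ) (x t : R) :
    bessel (n + 2) x t = (4 * n + 6) * t * bessel (n + 1) x t + x ^ 2 * bessel n x t := by
  have h1 : x ^ 2 * bessel n x t =
      ∑ i ∈ range (n + 3), (besselCoeff n i : R) * t ^ i * x ^ (n + 2 - i) := by
    rw [Finset.sum_range_succ, Finset.sum_range_succ, besselCoeff_eq_zero (by omega),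
      besselCoeff_eq_zero (by omega), bessel, Finset.mul_sum]
    simp only [Nat.cast_zero, zero_mul, add_zero]
    refine Finset.sum_congr rfl fun i hi => ?_
    rw [Finset.mem_range] at hi
    rw [show n + 2 - i = n - i + 2 by omega]; ring
  rw [h1, bessel, Finset.sum_range_succ', Finset.sum_range_succ' _ (n + 2), bessel, Finset.mul_sum,
    ← add_assoc, ← Finset.sum_add_distrib, besselCoeff_zero_right, besselCoeff_zero_right]
  congr 1
  refine Finset.sum_congr rfl fun i _ => ?_
  rw [besselCoeff_succ_succ, show n + 2 - (i + 1) = n + 1 - i by omega]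
  push_cast; ring

lemma bessel_intCast (n : ℕ) (x t : ℤ) :
    ((bessel n x t : ℤ) : ℝ) = bessel n (x : ℝ) (t : ℝ) := by
  simp [bessel]

lemma abs_bessel_le (n : ℕ) (x : ℝ) {t : ℝ} (ht : 0 ≤ t) :
    |bessel n x t| ≤ bessel n |x| t := by
  refine (Finset.abs_sum_le_sum_abs _ _).trans (le_of_eq (Finset.sum_congr rfl fun i _ => ?_))
  simp [abs_mul, abs_pow, abs_of_nonneg ht]

lemma bessel_pos (n : ℕ) {x t : ℝ} (hx : 0 < x) (ht : 0 < t) : 0 < bessel n x t := by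
  refine Finset.sum_pos' (fun i _ => by positivity) ⟨0, by simp, ?_⟩
  rw [besselCoeff_zero_right]; simp; positivity

/-- The Casoratian of the two solutions of the recurrence given by `x = -s` and `x = s`. -/
lemma bessel_casoratian {R : Type*} [CommRing R] (n : ℕ) (s t : R) :
    bessel (n + 1) (-s) t * bessel n s t - bessel n (-s) t * bessel (n + 1) s t
      = (-1) ^ (n + 1) * 2 * s ^ (2 * n + 1) := by
  induction n with
  | zero => simp [bessel_zero, bessel_one]; ring
  | succ n ih =>
    rw [bessel_add_two, bessel_add_two]
    linear_combination (-s ^ 2) * ih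

lemma bessel_add_two_le (n : ℕ) {x t : ℝ} (hx : 0 < x) (ht : 1 ≤ t) :
    bessel (n + 2) x t ≤ ((4 * n + 6) * t + x ^ 2) * bessel (n + 1) x t := by
  have hmono : ∀ n : ℕ, bessel n x t ≤ bessel (n + 1) x t := by
    intro n
    rcases n with _ | n
    · rw [bessel_zero, bessel_one]; linarith
    · rw [bessel_add_two]
      have h1 := bessel_pos (n + 1) hx (by linarith : (0 : ℝ) < t)
      have h2 := bessel_pos n hx (by linarith : (0 : ℝ) < t)
      have h3 : (1 : ℝ) ≤ (4 * n + 6) * t := by nlinarith [Nat.cast_nonneg (α := ℝ) n]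
      nlinarith [mul_nonneg (sq_nonneg x) h2.le]
  rw [bessel_add_two, add_mul]
  have := mul_le_mul_of_nonneg_left (hmono n) (sq_nonneg x)
  linarith

/-! ### The common factor of numerators and denominators -/

/-- A common factor of `bessel n s t` and `bessel n (-s) t`: over the primes `p` dividing `s`, the
product of the powers of `p` that divide `n!` exactly, with `2 ^ n` as the factor at `p = 2`. -/
def commonFactor (s : ℤ) (n : ℕ) : ℕ :=
  ∏ p ∈ s.natAbs.primeFactors, p ^ (if p = 2 then n else padicValNat p n !)

lemma commonFactor_pos (s : ℤ) (n : ℕ) : 0 < commonFactor s n :=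
  Finset.prod_pos fun _ hp => pow_pos (Nat.prime_of_mem_primeFactors hp).pos _

lemma commonFactor_mono (s : ℤ) : Monotone (commonFactor s) := by
  intro m n hmn
  refine Finset.prod_le_prod' fun p hp => ?_
  have hp' := Nat.prime_of_mem_primeFactors hp
  have := Fact.mk hp'
  refine Nat.pow_le_pow_right hp'.pos ?_
  split_ifs
  · exact hmn
  · exact (padicValNat_dvd_iff_le (Nat.factorial_ne_zero n)).1
      (pow_padicValNat_dvd.trans (Nat.factorial_dvd_factorial hmn))

lemma commonFactor_one (s : ℤ) : commonFactor s 1 ≤ Int.gcd 2 s := by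
  have h : ∀ p ∈ s.natAbs.primeFactors,
      p ^ (if p = 2 then 1 else padicValNat p 1 !) = if p = 2 then 2 else 1 := by
    intro p _
    split_ifs with h <;> simp [h]
  rw [commonFactor, Finset.prod_congr rfl h, Finset.prod_ite_eq']
  refine Nat.le_of_dvd (Int.gcd_pos_of_ne_zero_left _ (by norm_num)) ?_
  split_ifs with h2
  · have := Nat.dvd_of_mem_primeFactors h2
    exact Int.dvd_gcd (by norm_num) (by omega)
  · simp

lemma two_pow_dvd_factorial_mul_centralBinom (i : ℕ) : 2 ^ i ∣ i ! * i.centralBinom := by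
  induction i with
  | zero => simp
  | succ i ih =>
    have : (i + 1)! * (i + 1).centralBinom = 2 * ((2 * i + 1) * (i ! * i.centralBinom)) := by
      rw [Nat.factorial_succ]
      calc (i + 1) * i ! * (i + 1).centralBinom = i ! * ((i + 1) * (i + 1).centralBinom) := by ring
        _ = _ := by rw [Nat.succ_mul_centralBinom_succ]; ring
    rw [this, pow_succ']
    exact mul_dvd_mul_left 2 (ih.mul_left _)

lemma factorial_dvd_besselCoeff_mul {n i : ℕ} (h : i ≤ n) :
    n ! ∣ besselCoeff n i * (n - i)! := by
  have h1 : besselCoeff n i * (n - i)! * i ! = (n + i)! := by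
    have e1 := Nat.choose_mul_factorial_mul_factorial (show 2 * i ≤ n + i by omega)
    have e2 : i.centralBinom * i ! * i ! = (2 * i)! := by
      have := Nat.choose_mul_factorial_mul_factorial (show i ≤ 2 * i by omega)
      rwa [show 2 * i - i = i by omega] at this
    rw [show n + i - 2 * i = n - i by omega, ← e2] at e1
    rw [← e1, besselCoeff]; ring
  refine Nat.dvd_of_mul_dvd_mul_right (Nat.factorial_pos i) ?_
  rw [h1]
  exact Nat.factorial_mul_factorial_dvd_factorial_add n i

/-- At `p = 2` the factor `(2 i)! / i!` supplies `2 ^ i`; at odd `p` the loss `(n - i)!` against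
`n!` is made up by `p ^ (n - i)`. -/
lemma prime_pow_dvd_besselCoeff_mul {p n i : ℕ} (hp : p.Prime) (h : i ≤ n) :
    p ^ (if p = 2 then n else padicValNat p n !) ∣ besselCoeff n i * p ^ (n - i) := by
  have := Fact.mk hp
  split_ifs with h2
  · subst h2
    have := two_pow_dvd_factorial_mul_centralBinom i
    calc 2 ^ n = 2 ^ i * 2 ^ (n - i) := by rw [← pow_add]; congr 1; omega
      _ ∣ _ := mul_dvd_mul_right (this.mul_left _) _
  · have hb : besselCoeff n i ≠ 0 := by
      intro h0
      rw [besselCoeff, mul_eq_zero, Nat.choose_eq_zero_iff] at h0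
      rcases h0 with h0 | h0
      · omega
      · exact (mul_pos (Nat.factorial_pos i) i.centralBinom_pos).ne' h0
    have h1 : padicValNat p n ! ≤ padicValNat p (besselCoeff n i * (n - i)!) :=
      (padicValNat_dvd_iff_le (mul_ne_zero hb (Nat.factorial_ne_zero _))).1
        (pow_padicValNat_dvd.trans (factorial_dvd_besselCoeff_mul h))
    have h3 : padicValNat p (n - i)! ≤ n - i := by
      have := sub_one_mul_padicValNat_factorial (p := p) (n - i)
      have hp1 : 1 ≤ p - 1 := by have := hp.two_le; omega
      nlinarith [Nat.sub_le (n - i) (p.digits (n - i)).sum]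
    refine (padicValNat_dvd_iff_le (mul_ne_zero hb (pow_ne_zero _ hp.ne_zero))).2 ?_
    rw [padicValNat.mul hb (Nat.factorial_ne_zero _)] at h1
    rw [padicValNat.mul hb (pow_ne_zero _ hp.ne_zero), padicValNat.prime_pow]
    omega

lemma commonFactor_dvd_bessel (s t : ℤ) (n : ℕ) {x : ℤ} (hx : s ∣ x) :
    (commonFactor s n : ℤ) ∣ bessel n x t := by
  refine Finset.dvd_sum fun i hi => ?_
  have hi' : i ≤ n := by rw [Finset.mem_range] at hi; omega
  rw [commonFactor, Nat.cast_prod]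
  refine Finset.prod_dvd_of_coprime (fun p hp q hq hpq => ?_) fun p hp => ?_
  · have := (Nat.coprime_primes (Nat.prime_of_mem_primeFactors hp)
      (Nat.prime_of_mem_primeFactors hq)).2 hpq
    exact Nat.Coprime.isCoprime (Nat.Coprime.pow _ _ this)
  · have h1 := Int.natCast_dvd_natCast.2
      (prime_pow_dvd_besselCoeff_mul (Nat.prime_of_mem_primeFactors hp) hi')
    have h2 : (p : ℤ) ∣ x := (Int.natCast_dvd.2 (Nat.dvd_of_mem_primeFactors hp)).trans hx
    have h3 : ((besselCoeff n i * p ^ (n - i) : ℕ) : ℤ) ∣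
        (besselCoeff n i : ℤ) * t ^ i * x ^ (n - i) := by
      push_cast
      rw [mul_right_comm]
      exact (mul_dvd_mul_left _ (pow_dvd_pow_of_dvd h2 _)).mul_right _
    exact h1.trans h3

/-- The `p`-part of `n!` is `p ^ ((n - S) / (p - 1))`, where the digit sum `S` of `n` in base `p` is
at most `p - 1` times the number of digits. -/
lemma rpow_le_mul_pow_padicValNat_factorial {p n : ℕ} (hp : p.Prime) (hn : 1 ≤ n) :
    ((p : ℝ) ^ (1 / ((p : ℝ) - 1))) ^ n ≤ p * n * (p : ℝ) ^ padicValNat p n ! := by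
  have := Fact.mk hp
  have hp1 : (1 : ℝ) < p := by exact_mod_cast hp.one_lt
  have hlen : (p : ℝ) ^ ((p.digits n).length) ≤ p * n := by
    have := Nat.base_pow_length_digits_le p n hp.two_le (by omega)
    exact_mod_cast this
  have hsum : (p.digits n).sum ≤ (p.digits n).length * (p - 1) := by
    refine List.sum_le_card_nsmul _ _ fun x hx => ?_
    have := Nat.digits_lt_base hp.one_lt hx
    omega
  have hleg := sub_one_mul_padicValNat_factorial (p := p) n
  have hle : n ≤ (p - 1) * (padicValNat p n ! + (p.digits n).length) := by
    rw [mul_add, hleg, mul_comm (p - 1) (p.digits n).length]; omega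
  have hle' : (n : ℝ) ≤ ((p : ℝ) - 1) * (padicValNat p n ! + (p.digits n).length) := by
    have : ((p - 1 : ℕ) : ℝ) = (p : ℝ) - 1 := by rw [Nat.cast_sub hp.one_lt.le]; simp
    rw [← this]; exact_mod_cast hle
  rw [← Real.rpow_natCast, ← Real.rpow_mul (by positivity)]
  calc (p : ℝ) ^ (1 / ((p : ℝ) - 1) * n)
      ≤ (p : ℝ) ^ ((padicValNat p n ! + (p.digits n).length : ℕ) : ℝ) := by
        refine Real.rpow_le_rpow_of_exponent_le hp1.le ?_
        rw [one_div, inv_mul_le_iff₀ (by linarith)]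
        exact_mod_cast hle'
    _ = (p : ℝ) ^ ((p.digits n).length) * (p : ℝ) ^ padicValNat p n ! := by
        rw [Real.rpow_natCast, pow_add, mul_comm]
    _ ≤ _ := by gcongr

lemma alpha_pow_le (s : ℤ) {n : ℕ} (hn : 1 ≤ n) :
    alpha s ^ n ≤ gamma s * (n : ℝ) ^ beta s * commonFactor s n := by
  have hn' : (1 : ℝ) ≤ n := by exact_mod_cast hn
  have key : ∀ p ∈ s.natAbs.primeFactors, ((p : ℝ) ^ (1 / ((p : ℝ) - 1))) ^ n ≤
      (if p = 2 then 1 else (p : ℝ) * n) * (p : ℝ) ^ (if p = 2 then n else padicValNat p n !) := by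
    intro p hp
    split_ifs with h2
    · subst h2; norm_num
    · exact rpow_le_mul_pow_padicValNat_factorial (Nat.prime_of_mem_primeFactors hp) hn
  have hprod : ∏ p ∈ s.natAbs.primeFactors, (if p = 2 then 1 else (p : ℝ) * n)
      = gamma s * (n : ℝ) ^ beta s := by
    rw [gamma, beta, ← Finset.prod_const, ← Finset.prod_mul_distrib]
    refine (Finset.prod_subset_one_on_sdiff (Finset.erase_subset 2 _) ?_ ?_).symm
    · intro p hp
      simp only [Finset.mem_sdiff, Finset.mem_erase, not_and] at hp
      by_cases h : p = 2
      · simp [h]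
      · exact absurd hp.1 (hp.2 h)
    · intro p hp
      simp [(Finset.mem_erase.1 hp).1]
  calc alpha s ^ n = ∏ p ∈ s.natAbs.primeFactors, ((p : ℝ) ^ (1 / ((p : ℝ) - 1))) ^ n := by
        rw [alpha, Finset.prod_pow]
    _ ≤ ∏ p ∈ s.natAbs.primeFactors, ((if p = 2 then 1 else (p : ℝ) * n) *
          (p : ℝ) ^ (if p = 2 then n else padicValNat p n !)) :=
        Finset.prod_le_prod (fun p _ => by positivity) key
    _ = _ := by
        rw [Finset.prod_mul_distrib, hprod, commonFactor]; push_cast; rfl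

lemma alpha_pos (s : ℤ) : 0 < alpha s :=
  Finset.prod_pos fun p hp =>
    Real.rpow_pos_of_pos (by exact_mod_cast (Nat.prime_of_mem_primeFactors hp).pos) _

lemma gamma_pos (s : ℤ) : 0 < gamma s :=
  Finset.prod_pos fun p hp => by
    exact_mod_cast (Nat.prime_of_mem_primeFactors (Finset.mem_of_mem_erase hp)).pos

/-- The quotient `|s| / alpha s` stays away from `1`: an odd prime `q` dividing `s` contributes at
least `√q ≥ √3` to it, and otherwise `alpha s ≤ 2`. -/
lemma three_halves_mul_alpha_le {s : ℤ} (hs : 3 ≤ |s|) : 3 / 2 * alpha s ≤ |(s : ℝ)| := by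
  have hs' : (3 : ℝ) ≤ |(s : ℝ)| := by exact_mod_cast hs
  have hs0 : s.natAbs ≠ 0 := by intro h; rw [Int.natAbs_eq_zero] at h; simp [h] at hs
  by_cases h : ∃ q ∈ s.natAbs.primeFactors, q ≠ 2
  · obtain ⟨q, hq, hq2⟩ := h
    have hq3 : 3 ≤ q := by have := (Nat.prime_of_mem_primeFactors hq).two_le; omega
    have hq3' : (3 : ℝ) ≤ q := by exact_mod_cast hq3
    have h1 : (q : ℝ) ^ (1 / ((q : ℝ) - 1)) ≤ √q := by
      rw [Real.sqrt_eq_rpow]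
      exact Real.rpow_le_rpow_of_exponent_le (by linarith)
        (one_div_le_one_div_of_le (by norm_num) (by linarith))
    have h2 : 3 / 2 * √q ≤ q := by
      have h3 : 3 / 2 ≤ √(q : ℝ) := Real.le_sqrt_of_sq_le (by linarith)
      nlinarith [Real.mul_self_sqrt (by linarith : (0 : ℝ) ≤ q), Real.sqrt_nonneg (q : ℝ)]
    have h4 : ∏ p ∈ s.natAbs.primeFactors.erase q, (p : ℝ) ^ (1 / ((p : ℝ) - 1)) ≤
        ∏ p ∈ s.natAbs.primeFactors.erase q, (p : ℝ) := by
      refine Finset.prod_le_prod (fun p _ => by positivity) fun p hp => ?_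
      have hp2 : (2 : ℝ) ≤ p := by
        exact_mod_cast (Nat.prime_of_mem_primeFactors (Finset.mem_of_mem_erase hp)).two_le
      calc (p : ℝ) ^ (1 / ((p : ℝ) - 1)) ≤ (p : ℝ) ^ (1 : ℝ) :=
            Real.rpow_le_rpow_of_exponent_le (by linarith)
              (by rw [div_le_one (by linarith)]; linarith)
        _ = p := Real.rpow_one _
    have h5 : (∏ p ∈ s.natAbs.primeFactors, (p : ℝ)) ≤ |(s : ℝ)| := by
      have := Nat.le_of_dvd (Nat.pos_of_ne_zero hs0) (Nat.prod_primeFactors_dvd s.natAbs)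
      have h : ((∏ p ∈ s.natAbs.primeFactors, p : ℕ) : ℝ) ≤ (s.natAbs : ℕ) := Nat.cast_le.2 this
      rwa [Nat.cast_prod, Nat.cast_natAbs, Int.cast_abs] at h
    rw [alpha, ← Finset.mul_prod_erase _ _ hq]
    rw [← Finset.mul_prod_erase _ _ hq] at h5
    refine le_trans ?_ h5
    rw [← mul_assoc]
    refine mul_le_mul ?_ h4 (Finset.prod_nonneg fun p _ => by positivity) (by positivity)
    linarith
  · push Not at h
    have h1 : alpha s ≤ 2 := by
      rcases Finset.subset_singleton_iff.1 (fun q hq => Finset.mem_singleton.2 (h q hq) :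
        s.natAbs.primeFactors ⊆ {2}) with h | h <;> norm_num [alpha, h]
    linarith

end Arithmetic

/-! ### Hermite's integral -/

section Integral

open intervalIntegral

/-- The integral `∫₀¹ (u (1 - u)) ^ n exp (z u) du` in Hermite's form of the Padé remainder. -/
noncomputable def hermiteIntegral (n : ℕ) (z : ℝ) : ℝ :=
  ∫ u in (0 : ℝ)..1, (u * (1 - u)) ^ n * Real.exp (z * u)

lemma hermiteIntegral_pos (n : ℕ) (z : ℝ) : 0 < hermiteIntegral n z := by
  refine intervalIntegral_pos_of_pos_on (Continuous.intervalIntegrable (by fun_prop) _ _) ?_ one_pos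
  intro u hu
  have := hu.1
  have := sub_pos.2 hu.2
  positivity

lemma hasDerivAt_hermite (n : ℕ) (z u : ℝ) :
    HasDerivAt (fun u => Real.exp (z * u) *
        (z * (u * (1 - u)) ^ (n + 1) - (n + 1) * (u * (1 - u)) ^ n * (1 - 2 * u)))
      (Real.exp (z * u) * (z ^ 2 * (u * (1 - u)) ^ (n + 1)
        - (n + 1) * (n * (u * (1 - u)) ^ (n - 1) * (1 - 2 * u) ^ 2)
        + 2 * (n + 1) * (u * (1 - u)) ^ n)) u := by
  have hw : HasDerivAt (fun u : ℝ => u * (1 - u)) (1 - 2 * u) u := by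
    have := (hasDerivAt_id u).mul ((hasDerivAt_id u).const_sub 1)
    refine this.congr_deriv ?_
    simp; ring
  have he : HasDerivAt (fun u => Real.exp (z * u)) (Real.exp (z * u) * z) u := by
    have := ((hasDerivAt_id u).const_mul z).exp
    simpa using this
  have hl : HasDerivAt (fun u : ℝ => 1 - 2 * u) (-2) u := by
    have := ((hasDerivAt_id u).const_mul 2).const_sub 1
    simpa using this
  have := he.mul (((hw.pow (n + 1)).const_mul z).sub
    ((((hw.pow n).const_mul ((n : ℝ) + 1))).mul hl))
  refine (this.congr_deriv ?_)
  simp only [Pi.pow_apply, Pi.sub_apply, Pi.mul_apply, Nat.add_sub_cancel]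
  push_cast
  ring

lemma hermiteIntegral_add_two (n : ℕ) (z : ℝ) :
    z ^ 2 * hermiteIntegral (n + 2) z = (n + 2) * (n + 1) * hermiteIntegral n z
      - (n + 2) * (4 * n + 6) * hermiteIntegral (n + 1) z := by
  have h := integral_eq_sub_of_hasDerivAt (a := (0 : ℝ)) (b := 1)
    (fun u _ => hasDerivAt_hermite (n + 1) z u)
    (Continuous.intervalIntegrable (by fun_prop) _ _)
  have hI : ∀ k : ℕ, IntervalIntegrable
      (fun u : ℝ => (u * (1 - u)) ^ k * Real.exp (z * u)) MeasureTheory.volume 0 1 :=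
    fun k => Continuous.intervalIntegrable (by fun_prop) _ _
  have e : ∀ u : ℝ, Real.exp (z * u) * (z ^ 2 * (u * (1 - u)) ^ (n + 1 + 1)
        - ((n + 1 : ℕ) + 1) * ((n + 1 : ℕ) * (u * (1 - u)) ^ (n + 1 - 1) * (1 - 2 * u) ^ 2)
        + 2 * ((n + 1 : ℕ) + 1) * (u * (1 - u)) ^ (n + 1))
      = z ^ 2 * ((u * (1 - u)) ^ (n + 2) * Real.exp (z * u))
        - (n + 2) * (n + 1) * ((u * (1 - u)) ^ n * Real.exp (z * u))
        + (n + 2) * (4 * n + 6) * ((u * (1 - u)) ^ (n + 1) * Real.exp (z * u)) := by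
    intro u; rw [Nat.add_sub_cancel]; push_cast; ring
  simp only [e] at h
  rw [integral_add (((hI _).const_mul _).sub ((hI _).const_mul _)) ((hI _).const_mul _),
    integral_sub ((hI _).const_mul _) ((hI _).const_mul _), integral_const_mul, integral_const_mul,
    integral_const_mul] at h
  simp at h
  unfold hermiteIntegral
  linarith

lemma mul_hermiteIntegral_zero (z : ℝ) : z * hermiteIntegral 0 z = Real.exp z - 1 := by
  simp [hermiteIntegral]

lemma sq_mul_hermiteIntegral_one (z : ℝ) :
    z ^ 2 * hermiteIntegral 1 z = Real.exp z + 1 - 2 * hermiteIntegral 0 z := by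
  have h := integral_eq_sub_of_hasDerivAt (a := (0 : ℝ)) (b := 1)
    (fun u _ => hasDerivAt_hermite 0 z u)
    (Continuous.intervalIntegrable (by fun_prop) _ _)
  have hI : ∀ k : ℕ, IntervalIntegrable
      (fun u : ℝ => (u * (1 - u)) ^ k * Real.exp (z * u)) MeasureTheory.volume 0 1 :=
    fun k => Continuous.intervalIntegrable (by fun_prop) _ _
  have e : ∀ u : ℝ, Real.exp (z * u) * (z ^ 2 * (u * (1 - u)) ^ (0 + 1)
        - ((0 : ℕ) + 1) * ((0 : ℕ) * (u * (1 - u)) ^ (0 - 1) * (1 - 2 * u) ^ 2)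
        + 2 * ((0 : ℕ) + 1) * (u * (1 - u)) ^ 0)
      = z ^ 2 * ((u * (1 - u)) ^ 1 * Real.exp (z * u))
        + 2 * ((u * (1 - u)) ^ 0 * Real.exp (z * u)) := by
    intro u; push_cast; ring
  simp only [e] at h
  rw [integral_add ((hI _).const_mul _) ((hI _).const_mul _), integral_const_mul,
    integral_const_mul] at h
  simp only [mul_one, sub_self, mul_zero, Real.exp_zero] at h
  unfold hermiteIntegral
  norm_num at h ⊢
  linarith

end Integral

/-! ### The Padé remainder -/

/-- The remainder `q exp (s / t) - p` of the `n`-th diagonal Padé approximant `p / q`. -/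
noncomputable def padeRemainder (s t : ℝ) (n : ℕ) : ℝ :=
  bessel n (-s) t * Real.exp (s / t) - bessel n s t

lemma padeRemainder_add_two (s t : ℝ) (n : ℕ) : padeRemainder s t (n + 2) =
    (4 * n + 6) * t * padeRemainder s t (n + 1) + s ^ 2 * padeRemainder s t n := by
  simp only [padeRemainder, bessel_add_two]; ring

lemma padeRemainder_eq (s : ℝ) {t : ℝ} (ht : 0 < t) (n : ℕ) : padeRemainder s t n =
    (-1) ^ n * s ^ (2 * n + 1) / (t ^ (n + 1) * n.factorial) * hermiteIntegral n (s / t) := by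
  induction n using Nat.twoStepInduction with
  | zero =>
    have := mul_hermiteIntegral_zero (s / t)
    simp [padeRemainder, bessel_zero, ← this]
  | one =>
    have h0 := mul_hermiteIntegral_zero (s / t)
    have h1 := sq_mul_hermiteIntegral_one (s / t)
    have : (-1) ^ 1 * s ^ (2 * 1 + 1) / (t ^ (1 + 1) * (Nat.factorial 1 : ℕ)) *
        hermiteIntegral 1 (s / t) = -s * ((s / t) ^ 2 * hermiteIntegral 1 (s / t)) := by
      simp; field_simp
    rw [this, h1]
    have h2 : s * hermiteIntegral 0 (s / t) = t * (Real.exp (s / t) - 1) := by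
      rw [← h0]; field_simp
    simp only [padeRemainder, bessel_one]
    linear_combination (-2) * h2
  | more n ih0 ih1 =>
    have h := hermiteIntegral_add_two n (s / t)
    rw [padeRemainder_add_two, ih0, ih1]
    have e : (-1) ^ (n + 2) * s ^ (2 * (n + 2) + 1) / (t ^ (n + 2 + 1) * (n + 2).factorial) *
        hermiteIntegral (n + 2) (s / t) = (-1) ^ n * s ^ (2 * n + 3) /
          (t ^ (n + 1) * (n + 2).factorial) * ((s / t) ^ 2 * hermiteIntegral (n + 2) (s / t)) := by
      field_simp; ring
    rw [e, h, Nat.factorial_succ (n + 1), Nat.factorial_succ n]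
    push_cast
    field_simp
    ring

lemma padeRemainder_ne_zero {s t : ℝ} (hs : s ≠ 0) (ht : 0 < t) (n : ℕ) :
    padeRemainder s t n ≠ 0 := by
  rw [padeRemainder_eq s ht]
  have := hermiteIntegral_pos n (s / t)
  have : (n.factorial : ℝ) ≠ 0 := by positivity
  positivity

lemma padeRemainder_mul_succ_nonpos (s : ℝ) {t : ℝ} (ht : 0 < t) (n : ℕ) :
    padeRemainder s t n * padeRemainder s t (n + 1) ≤ 0 := by
  rw [padeRemainder_eq s ht, padeRemainder_eq s ht]
  have h0 := hermiteIntegral_pos n (s / t)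
  have h1 := hermiteIntegral_pos (n + 1) (s / t)
  have e : (-1) ^ n * s ^ (2 * n + 1) / (t ^ (n + 1) * n.factorial) * hermiteIntegral n (s / t) *
      ((-1) ^ (n + 1) * s ^ (2 * (n + 1) + 1) / (t ^ (n + 1 + 1) * (n + 1).factorial) *
        hermiteIntegral (n + 1) (s / t)) = -((((-1 : ℝ) ^ n) ^ 2 * (s ^ (2 * n + 2)) ^ 2 /
        (t ^ (n + 1) * n.factorial) / (t ^ (n + 1 + 1) * (n + 1).factorial)) *
        hermiteIntegral n (s / t) * hermiteIntegral (n + 1) (s / t)) := by ring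
  rw [e]
  exact neg_nonpos.2 (by positivity)

lemma mul_abs_le_abs_sub {a b x y : ℝ} (hb : 0 ≤ b) (h : x * y ≤ 0) :
    a * |x| ≤ |a * x - b * y| := by
  rcases le_total 0 x with hx | hx
  · rcases hx.eq_or_lt with rfl | hx'
    · simp only [abs_zero, mul_zero]; exact abs_nonneg _
    · have hy : y ≤ 0 := by by_contra! hy; nlinarith
      rw [abs_of_nonneg hx]
      exact le_trans (by nlinarith) (le_abs_self _)
  · rcases hx.eq_or_lt with rfl | hx'
    · simp only [abs_zero, mul_zero]; exact abs_nonneg _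
    · have hy : 0 ≤ y := by by_contra! hy; nlinarith
      rw [abs_of_nonpos hx]
      exact le_trans (by nlinarith) (neg_le_abs _)

/-- The Casoratian of a positive solution of the recurrence and the alternating solution
`padeRemainder` bounds their product. -/
lemma bessel_abs_mul_abs_padeRemainder_le {s t : ℝ} (hs : s ≠ 0) (ht : 0 < t) (n : ℕ) :
    bessel (n + 1) |s| t * |padeRemainder s t n|
      ≤ 2 * Real.exp |s / t| * |s| ^ (2 * n + 1) := by
  have hc := bessel_casoratian n s t
  have hpos := fun n => (bessel_pos n (abs_pos.2 hs) ht).le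
  refine (mul_abs_le_abs_sub (hpos n) (padeRemainder_mul_succ_nonpos s ht n)).trans ?_
  rcases lt_or_gt_of_ne hs with h | h
  · rw [abs_of_neg h]
    have e : bessel (n + 1) (-s) t * padeRemainder s t n
        - bessel n (-s) t * padeRemainder s t (n + 1) = -((-1) ^ (n + 1) * 2 * s ^ (2 * n + 1)) := by
      rw [← hc]; simp only [padeRemainder]; ring
    rw [e, abs_neg, abs_mul, abs_mul, abs_pow, abs_pow, abs_neg, abs_one, one_pow, one_mul,
      abs_of_neg h, abs_two]
    have h1 : 1 ≤ Real.exp |s / t| := Real.one_le_exp (abs_nonneg _)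
    have h2 : 0 < (-s) ^ (2 * n + 1) := pow_pos (by linarith) _
    nlinarith
  · rw [abs_of_pos h]
    have e : bessel (n + 1) s t * padeRemainder s t n
        - bessel n s t * padeRemainder s t (n + 1)
        = Real.exp (s / t) * -((-1) ^ (n + 1) * 2 * s ^ (2 * n + 1)) := by
      rw [← hc]; simp only [padeRemainder]; ring
    rw [e, abs_mul, abs_neg, abs_mul, abs_mul, abs_pow, abs_pow, abs_neg, abs_one, one_pow, one_mul,
      abs_of_pos h, abs_two, abs_of_pos (Real.exp_pos _), abs_of_pos (div_pos h ht)]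
    linarith

/-- The solution of the Bessel recurrence with initial values `0, 1`; up to the factor `2 s` it is
the difference of numerator and denominator of the Padé approximant. -/
def besselOdd (s t : ℝ) : ℕ → ℝ
  | 0 => 0
  | 1 => 1
  | n + 2 => (4 * n + 6) * t * besselOdd s t (n + 1) + s ^ 2 * besselOdd s t n

lemma bessel_sub_bessel_neg (s t : ℝ) (n : ℕ) :
    bessel n s t - bessel n (-s) t = 2 * s * besselOdd s t n := by
  induction n using Nat.twoStepInduction with
  | zero => simp [bessel_zero, besselOdd]
  | one => simp [bessel_one, besselOdd]; ring
  | more n ih0 ih1 =>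
    rw [bessel_add_two, bessel_add_two, besselOdd]
    linear_combination s ^ 2 * ih0 + (4 * n + 6) * t * ih1

lemma besselOdd_nonneg (s : ℝ) {t : ℝ} (ht : 0 < t) (n : ℕ) : 0 ≤ besselOdd s t n := by
  induction n using Nat.twoStepInduction with
  | zero => simp [besselOdd]
  | one => simp [besselOdd]
  | more n ih0 ih1 => rw [besselOdd]; positivity

lemma le_besselOdd_succ (s : ℝ) {t : ℝ} (ht : 0 < t) (n : ℕ) :
    t ^ n * ((2 * n + 1).factorial / n.factorial : ℝ) ≤ besselOdd s t (n + 1) := by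
  induction n with
  | zero => simp [besselOdd]
  | succ n ih =>
    have h0 := mul_nonneg (sq_nonneg s) (besselOdd_nonneg s ht n)
    have e : t ^ (n + 1) * ((2 * (n + 1) + 1).factorial / (n + 1).factorial : ℝ)
        = (4 * n + 6) * t * (t ^ n * ((2 * n + 1).factorial / n.factorial : ℝ)) := by
      rw [show 2 * (n + 1) + 1 = 2 * n + 1 + 1 + 1 by ring, Nat.factorial_succ (2 * n + 1 + 1),
        Nat.factorial_succ (2 * n + 1), Nat.factorial_succ n]
      push_cast
      field_simp
      ring
    rw [e, besselOdd]
    have := mul_le_mul_of_nonneg_left ih (by positivity : 0 ≤ (4 * (n : ℝ) + 6) * t)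
    linarith

lemma abs_padeRemainder_le {s t : ℝ} (hs : s ≠ 0) (ht : 0 < t) (n : ℕ) :
    |padeRemainder s t n| * (t ^ n * ((2 * n + 1).factorial / n.factorial : ℝ))
      ≤ |Real.exp (s / t) - 1| * s ^ (2 * n) := by
  have hc := bessel_casoratian n s t
  have h1 := mul_abs_le_abs_sub (a := besselOdd s t (n + 1)) (besselOdd_nonneg s ht n)
    (padeRemainder_mul_succ_nonpos s ht n)
  have e : 2 * s * (besselOdd s t (n + 1) * padeRemainder s t n
        - besselOdd s t n * padeRemainder s t (n + 1))
      = (Real.exp (s / t) - 1) * ((-1) ^ n * 2 * s ^ (2 * n + 1)) := by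
    have a0 := bessel_sub_bessel_neg s t n
    have a1 := bessel_sub_bessel_neg s t (n + 1)
    simp only [padeRemainder] at *
    linear_combination (-(bessel n (-s) t * Real.exp (s / t) - bessel n s t)) * a1
      + (bessel (n + 1) (-s) t * Real.exp (s / t) - bessel (n + 1) s t) * a0
      - (Real.exp (s / t) - 1) * hc
  have e2 : besselOdd s t (n + 1) * padeRemainder s t n - besselOdd s t n * padeRemainder s t (n + 1)
      = (Real.exp (s / t) - 1) * ((-1) ^ n * s ^ (2 * n)) := by
    have : 2 * s ≠ 0 := by simpa using hs
    apply mul_left_cancel₀ this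
    rw [e]; ring
  rw [e2, abs_mul, abs_mul, abs_pow, abs_neg, abs_one, one_pow, one_mul,
    abs_of_nonneg (by rw [pow_mul]; positivity : 0 ≤ s ^ (2 * n))] at h1
  have h2 := mul_le_mul_of_nonneg_left (le_besselOdd_succ s ht n) (abs_nonneg (padeRemainder s t n))
  linarith

/-! ### Stirling's formula and the comparison of exponents -/

/-- Stirling's lower bound for `(2 n)!` against the upper bound for `n!`. -/
lemma sqrt_two_mul_factorial_le {n : ℕ} (hn : n ≠ 0) :
    √2 * ((4 * n / Real.exp 1) ^ n * n.factorial) ≤ √(Real.exp 1) * (2 * n).factorial := by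
  have hn0 : (0 : ℝ) < n := by exact_mod_cast Nat.pos_of_ne_zero hn
  have h1 : (n.factorial : ℝ) ≤ Real.exp 1 * √n * (n / Real.exp 1) ^ n := by
    obtain ⟨m, rfl⟩ := Nat.exists_eq_succ_of_ne_zero hn
    have h := Stirling.stirlingSeq'_antitone (Nat.zero_le m)
    simp only [Function.comp_apply, Nat.succ_eq_add_one, zero_add, Stirling.stirlingSeq_one] at h
    rw [Stirling.stirlingSeq, div_le_iff₀ (by positivity)] at h
    refine h.trans (le_of_eq ?_)
    rw [Real.sqrt_mul (by norm_num)]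
    field_simp
  have h2 := Stirling.le_factorial_stirling (2 * n)
  have h3 : √2 * Real.exp 1 * √n ≤ √(Real.exp 1) * √(2 * Real.pi * (2 * n : ℕ)) := by
    have e1 : Real.exp 1 = √(Real.exp 1) * √(Real.exp 1) :=
      (Real.mul_self_sqrt (Real.exp_pos 1).le).symm
    have e2 : √2 * √(Real.exp 1) * √n ≤ √(2 * Real.pi * (2 * n : ℕ)) := by
      rw [← Real.sqrt_mul (by norm_num), ← Real.sqrt_mul (by positivity)]
      refine Real.sqrt_le_sqrt ?_
      push_cast
      have := Real.exp_one_lt_d9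
      nlinarith [Real.pi_gt_three]
    calc √2 * Real.exp 1 * √n = √(Real.exp 1) * (√2 * √(Real.exp 1) * √n) := by
          nth_rw 1 [e1]; ring
      _ ≤ _ := by gcongr
  calc √2 * ((4 * n / Real.exp 1) ^ n * n.factorial)
      ≤ √2 * ((4 * n / Real.exp 1) ^ n * (Real.exp 1 * √n * (n / Real.exp 1) ^ n)) := by gcongr
    _ = √2 * Real.exp 1 * √n * ((4 * n / Real.exp 1) * (n / Real.exp 1)) ^ n := by
        rw [mul_pow]; ring
    _ = √2 * Real.exp 1 * √n * ((2 * n : ℕ) / Real.exp 1) ^ (2 * n) := by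
        rw [pow_mul]; congr 2; push_cast; ring
    _ ≤ √(Real.exp 1) * √(2 * Real.pi * (2 * n : ℕ)) * ((2 * n : ℕ) / Real.exp 1) ^ (2 * n) := by
        gcongr
    _ ≤ _ := by rw [mul_assoc]; gcongr

lemma four_exp_one_le_log {x : ℝ} (hx : Real.exp (4 * Real.exp 1) ≤ x) :
    4 * Real.exp 1 ≤ Real.log x :=
  (Real.le_log_iff_exp_le ((Real.exp_pos _).trans_le hx)).2 hx

lemma le_log_of_four_exp_one_le {y : ℝ} (hy : 4 * Real.exp 1 ≤ y) : 2.38 ≤ Real.log y := by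
  have h := Real.log_le_log (by positivity) hy
  rw [Real.log_mul (by norm_num) (Real.exp_ne_zero _), Real.log_exp,
    show (4 : ℝ) = 2 ^ 2 by norm_num, Real.log_pow] at h
  have := Real.log_two_gt_d9
  norm_num at h ⊢
  linarith

lemma log_le_of_four_exp_one_le {y : ℝ} (hy : 4 * Real.exp 1 ≤ y) : Real.log y ≤ 0.22 * y := by
  have he := Real.exp_one_gt_d9
  have hy0 : 0 < y := by linarith
  have h : Real.log y / y ≤ Real.log (4 * Real.exp 1) / (4 * Real.exp 1) :=
    Real.log_div_self_antitoneOn (by simp; linarith) (by simp; linarith) hy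
  rw [Real.log_mul (by norm_num) (Real.exp_ne_zero _), Real.log_exp,
    show Real.log 4 = 2 * Real.log 2 by
      rw [show (4 : ℝ) = 2 ^ 2 by norm_num, Real.log_pow]; norm_num,
    div_le_div_iff₀ hy0 (by positivity)] at h
  have := Real.log_two_lt_d9
  nlinarith

/-- Since `exp x / x` is increasing for `x ≥ 1`, at `x = y / 4 ≥ e` it is at least
`exp (e - 1) > 16 / 3`. -/
lemma le_exp_div_four {y : ℝ} (hy : 4 * Real.exp 1 ≤ y) : y ≤ 0.75 * Real.exp (y / 4) := by
  have he := Real.exp_one_gt_d9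
  have he' := Real.exp_one_lt_d9
  have h1 : y / 4 - Real.exp 1 + 1 ≤ Real.exp (y / 4 - Real.exp 1) := Real.add_one_le_exp _
  have h2 : (5.4 : ℝ) ≤ Real.exp (Real.exp 1 - 1) := by
    have h4 : Real.exp 1.7 ≤ Real.exp (Real.exp 1 - 1) := Real.exp_le_exp.2 (by linarith)
    have h5 : Real.exp 1.7 = Real.exp 1 * (Real.exp 0.35 * Real.exp 0.35) := by
      rw [← Real.exp_add, ← Real.exp_add]; norm_num
    have h6 := Real.quadratic_le_exp_of_nonneg (show (0 : ℝ) ≤ 0.35 by norm_num)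
    norm_num at h5 h6 ⊢
    nlinarith
  have h7 : Real.exp (y / 4) =
      Real.exp (y / 4 - Real.exp 1) * (Real.exp (Real.exp 1 - 1) * Real.exp 1) := by
    rw [← Real.exp_add, ← Real.exp_add]; congr 1; ring
  have h8 : 5.4 * Real.exp 1 ≤ Real.exp (Real.exp 1 - 1) * Real.exp 1 := by gcongr
  have h9 : (y / 4 - Real.exp 1 + 1) * (5.4 * Real.exp 1) ≤ Real.exp (y / 4) := by
    rw [h7]; exact mul_le_mul h1 h8 (by positivity) (Real.exp_pos _).le
  nlinarith

/-- The comparison of exponents. Here `x = log N`, `x / (log x - log log x - a)` bounds the solution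
`y` of `y log (σ y) = log N` when `-log σ ≤ a`, and `c = 1.3` resp. `c = 3.6 + 1.52 a` is chosen so
that this bound is at most `x / log x * (1 + c ε)` with `ε = log log x / log x`. The terms in `z` and
`b` cost at most `0.36 ε` and `0.6 ε`, and `c + 0.96 ≤ r`. -/
lemma exponent_le {x a r w b z : ℝ} (hx : Real.exp (4 * Real.exp 1) ≤ x) (ha : 0 ≤ a)
    (hax : 2 * a ≤ Real.log x) (hr : a = 0 ∧ r = 7 / 3 ∨ r = 5 + 2 * a) (hw : 0 < w) (hb : 0 ≤ b)
    (hbx : b ≤ x ^ (1 / 2 : ℝ)) (hz : z ≤ 3 * w * x ^ (1 / 2 : ℝ))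
    (hbr : (2 * b + 1) * r ≤ 2 * w * x ^ (3 / 4 : ℝ)) :
    z + (2 * b + 1) * Real.log
        ((x / (Real.log x - Real.log (Real.log x) - a) + b) / (x / Real.log x))
      + 2 * (x / (Real.log x - Real.log (Real.log x) - a)) * w
      ≤ 2 * (x / Real.log x) * (1 + r * (Real.log (Real.log x) / Real.log x)) * w := by
  have hx0 : 0 < x := (Real.exp_pos _).trans_le hx
  have hy := four_exp_one_le_log hx
  have hl1 := le_log_of_four_exp_one_le hy
  have hl2 := log_le_of_four_exp_one_le hy
  have hl3 := le_exp_div_four hy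
  have he := Real.exp_one_gt_d9
  set y := Real.log x with hydef
  set l := Real.log y
  set v := Real.exp (y / 4) with hvdef
  have hy0 : 0 < y := by linarith
  have hv0 : 0 < v := Real.exp_pos _
  have hpow : ∀ q : ℝ, x ^ q = Real.exp (y * q) := fun q => by
    rw [Real.rpow_def_of_pos hx0]
  have hx4 : x = v ^ 4 := by
    rw [hvdef, ← Real.exp_nat_mul, ← Real.exp_log hx0]; congr 1; push_cast; ring
  have hx2 : x ^ (1 / 2 : ℝ) = v ^ 2 := by
    rw [hpow, hvdef, ← Real.exp_nat_mul]; congr 1; push_cast; ring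
  have hx3 : x ^ (3 / 4 : ℝ) = v ^ 3 := by
    rw [hpow, hvdef, ← Real.exp_nat_mul]; congr 1; push_cast; ring
  rw [hx2] at hbx hz
  rw [hx3] at hbr
  set ε := l / y with hε
  have hlε : l = ε * y := by rw [hε]; field_simp
  have hε0 : 0 < ε := by positivity
  have hε1 : ε ≤ 0.22 := by rw [hε, div_le_iff₀ hy0]; exact hl2
  set Λ := x / y with hΛ
  have hΛ0 : 0 < Λ := by positivity
  have hxΛ : x = Λ * y := by rw [hΛ]; field_simp
  have hv3 : v ^ 3 ≤ 0.75 * Λ := by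
    have : v ^ 3 * y ≤ 0.75 * Λ * y := by
      rw [mul_assoc, ← hxΛ, hx4]
      nlinarith [mul_le_mul_of_nonneg_left hl3 (pow_nonneg hv0.le 3)]
    exact le_of_mul_le_mul_right this hy0
  have hy2 : y ^ 2 ≤ 0.24 * l * v ^ 2 := by
    have h1 : y ^ 2 ≤ (0.75 * v) ^ 2 := pow_le_pow_left₀ hy0.le hl3 2
    nlinarith [mul_le_mul_of_nonneg_right hl1 (sq_nonneg v)]
  have hv2 : v ^ 2 ≤ 0.24 * ε * Λ := by
    have : v ^ 2 * y ^ 2 ≤ 0.24 * ε * Λ * y ^ 2 := by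
      have e : 0.24 * ε * Λ * y ^ 2 = 0.24 * l * v ^ 4 := by
        rw [← hx4, hxΛ, hlε]; ring
      rw [e]
      nlinarith [mul_le_mul_of_nonneg_left hy2 (sq_nonneg v)]
    exact le_of_mul_le_mul_right this (by positivity)
  have hden : 0.28 * y ≤ y - l - a := by linarith
  have hden0 : 0 < y - l - a := by linarith
  obtain ⟨c, hc0, hcY, hck, hcr⟩ : ∃ c : ℝ, 0 ≤ c ∧ y ≤ (y - l - a) * (1 + c * ε) ∧
      0.75 * (c + 0.24) ≤ 0.6 * r ∧ c + 0.96 ≤ r := by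
    rcases hr with ⟨rfl, rfl⟩ | rfl
    · refine ⟨1.3, by norm_num, ?_, by norm_num, by norm_num⟩
      rw [hlε]
      have : 0 ≤ y * ε * (0.3 - 1.3 * ε) := by
        have : 0 ≤ 0.3 - 1.3 * ε := by linarith
        positivity
      linarith
    · refine ⟨3.6 + 1.52 * a, by positivity, ?_, by linarith, by linarith⟩
      have h1 : 0.28 * y * ((3.6 + 1.52 * a) * ε) ≤ (y - l - a) * ((3.6 + 1.52 * a) * ε) := by
        gcongr
      have h2 : 2.38 * a ≤ a * l := by rw [mul_comm]; gcongr
      have h3 : 0.28 * y * ((3.6 + 1.52 * a) * ε) = 0.28 * (3.6 + 1.52 * a) * l := by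
        rw [hlε]; ring
      rw [h3] at h1
      linarith
  set Y := x / (y - l - a) with hY
  have hY0 : 0 < Y := by positivity
  have hYΛ : Y ≤ Λ * (1 + c * ε) := by
    rw [hY, div_le_iff₀ hden0, hxΛ]
    nlinarith [mul_le_mul_of_nonneg_left hcY hΛ0.le]
  have hlog : Real.log ((Y + b) / Λ) ≤ (c + 0.24) * ε := by
    refine (Real.log_le_sub_one_of_pos (by positivity)).trans ?_
    rw [sub_le_iff_le_add, div_le_iff₀ hΛ0]
    linarith
  have hr0 : 0 < r := by linarith
  have hterm : (2 * b + 1) * Real.log ((Y + b) / Λ) ≤ 2 * w * Λ * (0.6 * ε) := by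
    have h1 : (2 * b + 1) * Real.log ((Y + b) / Λ) ≤ (2 * b + 1) * ((c + 0.24) * ε) := by gcongr
    have h2 : (2 * b + 1) * r * ((c + 0.24) * ε) ≤ 2 * w * (0.75 * Λ) * ((c + 0.24) * ε) := by
      have : 2 * w * v ^ 3 ≤ 2 * w * (0.75 * Λ) := by gcongr
      exact mul_le_mul_of_nonneg_right (hbr.trans this) (by positivity)
    have h3 : 2 * w * Λ * ε * (0.75 * (c + 0.24)) ≤ 2 * w * Λ * ε * (0.6 * r) := by gcongr
    have h4 : (2 * b + 1) * ((c + 0.24) * ε) * r ≤ 2 * w * Λ * (0.6 * ε) * r := by linarith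
    exact h1.trans (le_of_mul_le_mul_right h4 hr0)
  have hz' : z ≤ 2 * w * Λ * (0.36 * ε) := by
    have : 3 * w * v ^ 2 ≤ 3 * w * (0.24 * ε * Λ) := by gcongr
    linarith
  have hYw : 2 * Y * w ≤ 2 * (Λ * (1 + c * ε)) * w := by gcongr
  have hfin : 2 * w * Λ * ε * (c + 0.96) ≤ 2 * w * Λ * ε * r := by gcongr
  linarith

/-- If `y log (σ y) ≤ x` and `-log σ ≤ a`, then `y` is at most `x / (log x - log log x - a)`. -/
lemma le_div_of_mul_log_le {x a σ y : ℝ} (hx : Real.exp (4 * Real.exp 1) ≤ x) (ha : 0 ≤ a)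
    (hax : 2 * a ≤ Real.log x) (hσ : 0 < σ) (hσa : -Real.log σ ≤ a)
    (h : 0 < y → y * Real.log (σ * y) ≤ x) :
    y ≤ x / (Real.log x - Real.log (Real.log x) - a) := by
  have hx0 : 0 < x := (Real.exp_pos _).trans_le hx
  have hl := four_exp_one_le_log hx
  have hl1 := le_log_of_four_exp_one_le hl
  have hl2 := log_le_of_four_exp_one_le hl
  have he := Real.exp_one_gt_d9
  have hden : 0 < Real.log x - Real.log (Real.log x) - a := by linarith
  set Y := x / (Real.log x - Real.log (Real.log x) - a) with hY
  have hY0 : 0 < Y := by positivity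
  by_contra! hlt
  have hle : x / Real.log x ≤ Y :=
    div_le_div_of_nonneg_left hx0.le hden (by linarith)
  have h1 : Real.log x - Real.log (Real.log x) ≤ Real.log Y := by
    rw [← Real.log_div hx0.ne' (by linarith)]
    exact Real.log_le_log (div_pos hx0 (by linarith)) hle
  have h2 : Real.log (σ * y) = Real.log σ + Real.log y :=
    Real.log_mul hσ.ne' (hY0.trans hlt).ne'
  have h3 : Real.log Y < Real.log y := Real.log_lt_log hY0 hlt
  have h4 := h (hY0.trans hlt)
  have h5 : Y * (Real.log x - Real.log (Real.log x) - a) = x := by rw [hY]; field_simp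
  have h6 : Y * (Real.log x - Real.log (Real.log x) - a) < y * Real.log (σ * y) :=
    mul_lt_mul' hlt.le (by linarith) hden.le (hY0.trans hlt)
  linarith

/-! ### The last index with a large remainder -/

lemma sigma_pos {s t : ℤ} (hs : s ≠ 0) (ht : 1 ≤ t) : 0 < sigma s t := by
  have h1 : (0 : ℝ) < t := by exact_mod_cast ht
  have h2 : (s : ℝ) ≠ 0 := by exact_mod_cast hs
  have := alpha_pos s
  unfold sigma
  positivity

lemma eventually_padeRemainder_lt {s t : ℝ} (hs : s ≠ 0) (ht : 1 ≤ t) {δ : ℝ} (hδ : 0 < δ) :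
    ∃ K : ℕ, ∀ n ≥ K, |padeRemainder s t n| < δ := by
  have h := (FloorSemiring.tendsto_pow_div_factorial_atTop (s ^ 2)).const_mul
    |Real.exp (s / t) - 1|
  rw [mul_zero] at h
  obtain ⟨K, hK⟩ := Filter.eventually_atTop.1 (h.eventually_lt_const hδ)
  refine ⟨K, fun n hn => lt_of_le_of_lt ?_ (hK n hn)⟩
  have h1 := abs_padeRemainder_le hs (by linarith : 0 < t) n
  have h2 : (n.factorial : ℝ) ≤ t ^ n * ((2 * n + 1).factorial / n.factorial : ℝ) := by
    have h3 : n.factorial * n.factorial ≤ (2 * n + 1).factorial :=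
      (Nat.le_of_dvd (Nat.factorial_pos _) (Nat.factorial_mul_factorial_dvd_factorial_add n n)).trans
        (Nat.factorial_le (by omega))
    have h4 : (n.factorial : ℝ) ≤ (2 * n + 1).factorial / n.factorial := by
      rw [le_div_iff₀ (by positivity)]; exact_mod_cast h3
    exact h4.trans (le_mul_of_one_le_left (by positivity) (one_le_pow₀ ht))
  rw [mul_div_assoc', le_div_iff₀ (by positivity), ← pow_mul]
  exact (mul_le_mul_of_nonneg_left h2 (abs_nonneg _)).trans h1

/-- The largest index at which the remainder, divided by the common factor, is at least
`1 / (2 N)`. -/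
lemma exists_last_large_remainder {s t : ℤ} (hs : s ≠ 0) (ht : 1 ≤ t) {N : ℝ} (hN : 0 < N)
    (h1 : (commonFactor s 1 : ℝ) ≤ 2 * N * |padeRemainder s t 1|) :
    ∃ m : ℕ, 1 ≤ m ∧ (commonFactor s m : ℝ) ≤ 2 * N * |padeRemainder s t m| ∧
      ∀ k > m, 2 * N * |padeRemainder s t k| < commonFactor s k := by
  classical
  obtain ⟨K, hK⟩ := eventually_padeRemainder_lt (s := (s : ℝ)) (t := (t : ℝ))
    (by exact_mod_cast hs) (by exact_mod_cast ht) (show 0 < 1 / (2 * N) by positivity)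
  have hlarge : ∀ k, (commonFactor s k : ℝ) ≤ 2 * N * |padeRemainder s t k| → k < K := by
    intro k hk
    by_contra! h
    have h2 := hK k h
    rw [lt_div_iff₀ (by positivity)] at h2
    have h3 : (1 : ℝ) ≤ commonFactor s k := by exact_mod_cast commonFactor_pos s k
    linarith
  let P : ℕ → Prop := fun k => (commonFactor s k : ℝ) ≤ 2 * N * |padeRemainder s t k|
  have hP1 : P 1 := h1
  refine ⟨Nat.findGreatest P K, Nat.le_findGreatest (hlarge 1 h1).le hP1,
    Nat.findGreatest_spec (P := P) (hlarge 1 h1).le hP1, fun k hk => ?_⟩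
  by_contra! h
  exact Nat.findGreatest_is_greatest hk (hlarge k h).le h

lemma commonFactor_one_le {s t : ℤ} (hs : s ≠ 0) (ht : 1 ≤ t) {N : ℝ} (hN : 0 < N)
    (h : logN1 s t ≤ Real.log N) :
    (commonFactor s 1 : ℝ) ≤ 2 * N * |padeRemainder s t 1| := by
  have ht' : (0 : ℝ) < t := by exact_mod_cast ht
  have hE : 4 * (s : ℝ) + 2 * ((s : ℝ) - 2 * t) * (Real.exp (s / t) - 1)
      = -2 * padeRemainder s t 1 := by
    rw [padeRemainder, bessel_one, bessel_one]; ring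
  have h1 := (le_max_right _ _).trans h
  have hpos := abs_pos.2 (padeRemainder_ne_zero (s := (s : ℝ)) (by exact_mod_cast hs) ht' 1)
  have hg : (0 : ℝ) < Int.gcd 2 s := by
    exact_mod_cast Int.gcd_pos_of_ne_zero_left _ (by norm_num)
  rw [hE, abs_mul, abs_neg, abs_two, Real.log_le_log_iff (by positivity) hN,
    div_le_iff₀ (by positivity)] at h1
  have h2 : (commonFactor s 1 : ℝ) ≤ Int.gcd 2 s := by exact_mod_cast commonFactor_one s
  linarith

/-- An index `m` at which the reduced remainder is at least `1 / (2 N)` is not much larger than the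
solution `y` of `y log (σ y) = log N`, shifted by `β`. -/
lemma sub_beta_mul_log_le {s t : ℤ} (hs : s ≠ 0) (ht : 1 ≤ t) {N : ℝ} (hN : 1 ≤ N)
    (h : logN1 s t ≤ Real.log N) {m : ℕ} (hm : 1 ≤ m)
    (hlarge : (commonFactor s m : ℝ) ≤ 2 * N * |padeRemainder s t m|)
    (hβ : 0 < (m : ℝ) - beta s) :
    ((m : ℝ) - beta s) * Real.log (sigma s t * ((m : ℝ) - beta s)) ≤ Real.log N := by
  have hσ := sigma_pos hs ht
  have ht' : (0 : ℝ) < t := by exact_mod_cast ht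
  have hs' : (s : ℝ) ≠ 0 := by exact_mod_cast hs
  have hα := alpha_pos s
  have hγ := gamma_pos s
  have hm' : (0 : ℝ) < m := by exact_mod_cast hm
  rcases lt_or_ge (m : ℝ) (eta s t) with hη | hη
  · -- Below `η` the first term of `log N₁` suffices.
    rcases le_total (sigma s t * ((m : ℝ) - beta s)) 1 with h1 | h1
    · exact (mul_nonpos_of_nonneg_of_nonpos hβ.le
        (Real.log_nonpos (by positivity) h1)).trans (Real.log_nonneg hN)
    · refine le_trans ?_ ((le_max_left _ _).trans h)
      have h2 : (m : ℝ) - beta s ≤ eta s t - beta s := by linarith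
      exact mul_le_mul h2 (Real.log_le_log (by positivity) (by gcongr)) (Real.log_nonneg h1)
        (hβ.le.trans h2)
  · -- From `η` on, the constants in the bound for the remainder are absorbed by the factor `m + 1 / 2`
    -- of `(2 m + 1)! / m!`, which leaves `(σ m) ^ m ≤ N (σ m) ^ β`.
    set D := |Real.exp ((s : ℝ) / t) - 1| with hD
    have hη1 : √(Real.exp 1) * D * gamma s ≤ √2 * (m + 1 / 2) * sigma s t ^ beta s := by
      have h1 := (le_max_left _ _).trans hη
      rw [sub_le_iff_le_add, div_le_iff₀ (by positivity)] at h1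
      linarith
    have hα1 := alpha_pow_le s hm
    have hE := abs_padeRemainder_le hs' ht' m
    have hst := sqrt_two_mul_factorial_le (n := m) (by omega)
    set σ := sigma s t with hσdef
    have hσs : σ * (s : ℝ) ^ 2 * Real.exp 1 = 4 * t * alpha s := by
      rw [hσdef, sigma]; field_simp
    set Q := t ^ m * ((2 * m + 1).factorial / m.factorial : ℝ) with hQ
    have hQ0 : 0 < Q := by positivity
    have h1 : alpha s ^ m * Q ≤ 2 * N * gamma s * (m : ℝ) ^ beta s * (D * (s : ℝ) ^ (2 * m)) := by
      calc alpha s ^ m * Q ≤ gamma s * (m : ℝ) ^ beta s * commonFactor s m * Q := by gcongr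
        _ ≤ gamma s * (m : ℝ) ^ beta s * (2 * N * |padeRemainder s t m|) * Q := by gcongr
        _ = 2 * N * gamma s * (m : ℝ) ^ beta s * (|padeRemainder s t m| * Q) := by ring
        _ ≤ _ := by gcongr
    have h2 : √2 * (2 * m + 1) * ((σ * m) ^ m * (s : ℝ) ^ (2 * m))
        ≤ √(Real.exp 1) * (alpha s ^ m * Q) := by
      have e1 : (2 * m + 1).factorial = (2 * m + 1) * (2 * m).factorial := Nat.factorial_succ _
      have e2 : (σ * m) ^ m * (s : ℝ) ^ (2 * m) = (t * alpha s) ^ m * (4 * m / Real.exp 1) ^ m := by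
        rw [pow_mul, ← mul_pow, ← mul_pow]
        congr 1
        field_simp
        linear_combination hσs
      have e3 : √(Real.exp 1) * (alpha s ^ m * Q) = (2 * m + 1) * (t * alpha s) ^ m *
          (√(Real.exp 1) * (2 * m).factorial) / m.factorial := by
        rw [hQ, e1, mul_pow]; push_cast; ring
      rw [e2, e3, le_div_iff₀ (by positivity)]
      have := mul_le_mul_of_nonneg_left hst
        (by positivity : (0 : ℝ) ≤ (2 * m + 1) * (t * alpha s) ^ m)
      linarith
    have h3 : √2 * (2 * m + 1) * (s : ℝ) ^ (2 * m) * (σ * m) ^ m ≤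
        √2 * (2 * m + 1) * (s : ℝ) ^ (2 * m) * (N * (σ * m) ^ beta s) := by
      have hs2 : 0 ≤ (s : ℝ) ^ (2 * m) := by rw [pow_mul]; positivity
      calc √2 * (2 * m + 1) * (s : ℝ) ^ (2 * m) * (σ * m) ^ m
          ≤ √(Real.exp 1) * (alpha s ^ m * Q) := by linarith
        _ ≤ √(Real.exp 1) * (2 * N * gamma s * (m : ℝ) ^ beta s * (D * (s : ℝ) ^ (2 * m))) := by
            gcongr
        _ = 2 * N * (m : ℝ) ^ beta s * (s : ℝ) ^ (2 * m) * (√(Real.exp 1) * D * gamma s) := by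
            ring
        _ ≤ 2 * N * (m : ℝ) ^ beta s * (s : ℝ) ^ (2 * m) *
            (√2 * (m + 1 / 2) * σ ^ beta s) := by gcongr
        _ = _ := by rw [mul_pow]; ring
    have h4 : (σ * m) ^ m ≤ N * (σ * m) ^ beta s := by
      refine le_of_mul_le_mul_left h3 ?_
      have : 0 < (s : ℝ) ^ (2 * m) := by rw [pow_mul]; positivity
      positivity
    have h5 := Real.log_le_log (by positivity) h4
    rw [Real.log_pow, Real.log_mul (x := N) (by positivity) (by positivity), Real.log_pow] at h5
    have h6 : Real.log (σ * ((m : ℝ) - beta s)) ≤ Real.log (σ * m) :=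
      Real.log_le_log (by positivity)
        (mul_le_mul_of_nonneg_left (by linarith [Nat.cast_nonneg (α := ℝ) (beta s)]) hσ.le)
    have h7 := mul_le_mul_of_nonneg_left h6 hβ.le
    linarith

/-- The two consecutive approximants after `m` cannot both be equal to `M / N`; for the other one
the integer `(q M - p N) / G`, where `G` is the common factor, is nonzero. -/
lemma commonFactor_lt_of_small_remainders {s t : ℤ} (hs : s ≠ 0) (ht : 1 ≤ t) {M N : ℤ}
    (hN : 0 < N) {m : ℕ}
    (hsmall : ∀ k > m, 2 * (N : ℝ) * |padeRemainder s t k| < commonFactor s k) :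
    ∃ k, (k = m + 1 ∨ k = m + 2) ∧ (commonFactor s k : ℝ) <
      2 * (N : ℝ) * |Real.exp ((s : ℝ) / t) - (M : ℝ) / N| * bessel k |(s : ℝ)| (t : ℝ) := by
  have hN' : (0 : ℝ) < N := by exact_mod_cast hN
  have ht' : (0 : ℝ) < t := by exact_mod_cast ht
  obtain ⟨k, hk, hne⟩ : ∃ k, (k = m + 1 ∨ k = m + 2) ∧
      bessel k (-s) t * M - bessel k s t * N ≠ 0 := by
    by_contra! h
    have h1 := h (m + 1) (Or.inl rfl)
    have h2 := h (m + 2) (Or.inr rfl)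
    have hc := bessel_casoratian (m + 1) s t
    have h3 : ((-1) ^ (m + 1 + 1) * 2 * s ^ (2 * (m + 1) + 1)) * N = 0 := by
      rw [← hc]
      linear_combination bessel (m + 1) (-s) t * h2 - bessel (m + 1 + 1) (-s) t * h1
    exact (mul_ne_zero (mul_ne_zero (mul_ne_zero (pow_ne_zero _ (by norm_num)) two_ne_zero)
      (pow_ne_zero _ hs)) hN.ne') h3
  refine ⟨k, hk, ?_⟩
  have hlt := hsmall k (by omega)
  have hdvd : (commonFactor s k : ℤ) ∣ bessel k (-s) t * M - bessel k s t * N :=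
    dvd_sub ((commonFactor_dvd_bessel s t k ((dvd_neg).2 dvd_rfl)).mul_right _)
      ((commonFactor_dvd_bessel s t k dvd_rfl).mul_right _)
  have hle : (commonFactor s k : ℤ) ≤ |bessel k (-s) t * M - bessel k s t * N| :=
    Int.le_of_dvd (abs_pos.2 hne) ((dvd_abs _ _).2 hdvd)
  have hle' : (commonFactor s k : ℝ) ≤
      |bessel k (-(s : ℝ)) (t : ℝ) * M - bessel k (s : ℝ) (t : ℝ) * N| := by
    have : ((commonFactor s k : ℤ) : ℝ) ≤ (|bessel k (-s) t * M - bessel k s t * N| : ℤ) :=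
      Int.cast_le.2 hle
    simpa [bessel_intCast] using this
  have e : bessel k (-(s : ℝ)) (t : ℝ) * M - bessel k (s : ℝ) (t : ℝ) * N =
      N * padeRemainder s t k
        - N * (Real.exp ((s : ℝ) / t) - (M : ℝ) / N) * bessel k (-(s : ℝ)) (t : ℝ) := by
    rw [padeRemainder]; field_simp; ring
  have hq := abs_bessel_le k (-(s : ℝ)) ht'.le
  rw [abs_neg] at hq
  set Δ := Real.exp ((s : ℝ) / t) - (M : ℝ) / N
  have h1 : (commonFactor s k : ℝ) ≤
      N * |padeRemainder s t k| + N * |Δ| * bessel k |(s : ℝ)| (t : ℝ) := by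
    rw [e] at hle'
    refine (hle'.trans (abs_sub _ _)).trans ?_
    rw [abs_mul, abs_mul, abs_mul, abs_of_pos hN']
    gcongr
  linarith

/-- The product of the remainder at `m` with a denominator at `m + 1` or `m + 2`, both divided by
their common factors. -/
lemma one_lt_of_last_large_remainder {s t : ℤ} (hs : s ≠ 0) (ht : 1 ≤ t) {M N : ℤ} (hN : 0 < N)
    {m : ℕ} (hm : 1 ≤ m) (hlarge : (commonFactor s m : ℝ) ≤ 2 * (N : ℝ) * |padeRemainder s t m|)
    (hsmall : ∀ k > m, 2 * (N : ℝ) * |padeRemainder s t k| < commonFactor s k) :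
    1 < 8 * (N : ℝ) ^ 2 * |Real.exp ((s : ℝ) / t) - (M : ℝ) / N| * gamma s ^ 2 *
      (((m : ℝ) + 1) * m) ^ beta s * ((4 * m + 6) * t + (s : ℝ) ^ 2) *
      (|(s : ℝ)| / alpha s) ^ (2 * m + 1) * Real.exp |(s : ℝ) / t| := by
  have hN' : (0 : ℝ) < N := by exact_mod_cast hN
  have ht1 : (1 : ℝ) ≤ t := by exact_mod_cast ht
  have ht' : (0 : ℝ) < t := by linarith
  have hs' : (s : ℝ) ≠ 0 := by exact_mod_cast hs
  have hα := alpha_pos s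
  have hγ := gamma_pos s
  obtain ⟨k, hk, hlt⟩ := commonFactor_lt_of_small_remainders (M := M) hs ht hN hsmall
  set Δ := |Real.exp ((s : ℝ) / t) - (M : ℝ) / N| with hΔ
  have hΔ0 : 0 ≤ Δ := abs_nonneg _
  set K := (4 * (m : ℝ) + 6) * t + (s : ℝ) ^ 2 with hK
  have hP : bessel k |(s : ℝ)| (t : ℝ) ≤ K * bessel (m + 1) |(s : ℝ)| (t : ℝ) := by
    rcases hk with rfl | rfl
    · refine le_mul_of_one_le_left (bessel_pos _ (abs_pos.2 hs') ht').le ?_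
      nlinarith [sq_nonneg (s : ℝ), Nat.cast_nonneg (α := ℝ) m]
    · have := bessel_add_two_le m (abs_pos.2 hs') ht1
      rwa [sq_abs] at this
  have hG : (commonFactor s (m + 1) : ℝ) ≤ commonFactor s k := by
    exact_mod_cast commonFactor_mono s (by omega)
  have hGm : (0 : ℝ) < commonFactor s m := by exact_mod_cast commonFactor_pos s m
  have hGm1 : (0 : ℝ) < commonFactor s (m + 1) := by exact_mod_cast commonFactor_pos s (m + 1)
  have hE := bessel_abs_mul_abs_padeRemainder_le hs' ht' m
  have h1 : (commonFactor s (m + 1) : ℝ) < 2 * N * Δ * (K * bessel (m + 1) |(s : ℝ)| (t : ℝ)) := by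
    refine (hG.trans_lt hlt).trans_le ?_
    gcongr
  have h2 : (commonFactor s (m + 1) : ℝ) * commonFactor s m <
      8 * N ^ 2 * Δ * K * Real.exp |(s : ℝ) / t| * |(s : ℝ)| ^ (2 * m + 1) := by
    calc (commonFactor s (m + 1) : ℝ) * commonFactor s m
        < 2 * N * Δ * (K * bessel (m + 1) |(s : ℝ)| (t : ℝ)) * (2 * N * |padeRemainder s t m|) :=
          mul_lt_mul h1 hlarge hGm (hGm1.trans h1).le
      _ = 4 * N ^ 2 * Δ * K * (bessel (m + 1) |(s : ℝ)| (t : ℝ) * |padeRemainder s t m|) := by ring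
      _ ≤ 4 * N ^ 2 * Δ * K * (2 * Real.exp |(s : ℝ) / t| * |(s : ℝ)| ^ (2 * m + 1)) := by gcongr
      _ = _ := by ring
  have ha : alpha s ^ (2 * m + 1) ≤ gamma s ^ 2 * (((m : ℝ) + 1) * m) ^ beta s *
      (commonFactor s (m + 1) * commonFactor s m) := by
    have a1 := alpha_pow_le s (n := m + 1) (by omega)
    have a2 := alpha_pow_le s hm
    push_cast at a1
    calc alpha s ^ (2 * m + 1) = alpha s ^ (m + 1) * alpha s ^ m := by ring
      _ ≤ (gamma s * ((m : ℝ) + 1) ^ beta s * commonFactor s (m + 1)) *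
          (gamma s * (m : ℝ) ^ beta s * commonFactor s m) := by gcongr
      _ = _ := by rw [mul_pow]; ring
  have hm' : (0 : ℝ) < m := by exact_mod_cast hm
  have h3 : alpha s ^ (2 * m + 1) < gamma s ^ 2 * (((m : ℝ) + 1) * m) ^ beta s *
      (8 * N ^ 2 * Δ * K * Real.exp |(s : ℝ) / t| * |(s : ℝ)| ^ (2 * m + 1)) :=
    ha.trans_lt (mul_lt_mul_of_pos_left h2 (by positivity))
  rw [div_pow]
  calc (1 : ℝ) < gamma s ^ 2 * (((m : ℝ) + 1) * m) ^ beta s *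
      (8 * N ^ 2 * Δ * K * Real.exp |(s : ℝ) / t| * |(s : ℝ)| ^ (2 * m + 1))
        / alpha s ^ (2 * m + 1) := (one_lt_div (by positivity)).2 h3
    _ = _ := by ring

lemma rpow_three_quarters_le_div_log {x : ℝ} (hx : Real.exp (4 * Real.exp 1) ≤ x) :
    x ^ (3 / 4 : ℝ) ≤ x / Real.log x := by
  have hx0 : 0 < x := (Real.exp_pos _).trans_le hx
  have hl := four_exp_one_le_log hx
  have hl0 : 0 < Real.log x := lt_of_lt_of_le (by positivity) hl
  have h := le_exp_div_four hl
  have h1 : x ^ (1 / 4 : ℝ) = Real.exp (Real.log x / 4) := by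
    rw [Real.rpow_def_of_pos hx0]; congr 1; ring
  have h2 : x = x ^ (3 / 4 : ℝ) * x ^ (1 / 4 : ℝ) := by
    rw [← Real.rpow_add hx0]; norm_num
  rw [le_div_iff₀ hl0]
  nth_rw 3 [h2]
  rw [h1]
  have := Real.exp_pos (Real.log x / 4)
  gcongr
  linarith

/-- As `σ = 4 t α / (e s²)`, the argument `|s / t|` is `4 / (e u σ)` with `u = |s| / α`. -/
lemma abs_div_le {s t : ℤ} (hs : 3 ≤ |s|) (ht : 1 ≤ t) {y : ℝ} (hy : (sigma s t)⁻¹ ≤ y) :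
    |(s : ℝ) / t| ≤ 3 * Real.log (|(s : ℝ)| / alpha s) * y := by
  have hs0 : s ≠ 0 := by rintro rfl; simp at hs
  have hs' : 0 < |(s : ℝ)| := abs_pos.2 (by exact_mod_cast hs0)
  have ht' : (0 : ℝ) < t := by exact_mod_cast ht
  have hα := alpha_pos s
  have hσ := sigma_pos hs0 ht
  set u := |(s : ℝ)| / alpha s with hu
  have hu1 : 3 / 2 ≤ u := by
    rw [hu, le_div_iff₀ hα]; exact three_halves_mul_alpha_le hs
  have hu0 : 0 < u := by linarith
  have e : |(s : ℝ) / t| = 4 / (Real.exp 1 * u) * (sigma s t)⁻¹ := by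
    rw [abs_div, abs_of_pos ht', sigma, ← sq_abs (s : ℝ), hu]
    field_simp
  rw [e]
  have h1 : 4 / (Real.exp 1 * u) ≤ 3 * Real.log u := by
    have h2 := Real.one_sub_inv_le_log_of_pos hu0
    have h3 := Real.exp_one_gt_d9
    have h4 : 4 / (Real.exp 1 * u) ≤ 3 * (1 - u⁻¹) := by
      rw [div_le_iff₀ (by positivity)]
      have : 3 * (1 - u⁻¹) * (Real.exp 1 * u) = 3 * Real.exp 1 * (u - 1) := by field_simp
      rw [this]
      nlinarith
    linarith
  have hσ' : 0 < (sigma s t)⁻¹ := inv_pos.2 hσ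
  have : 0 ≤ 4 / (Real.exp 1 * u) := by positivity
  exact mul_le_mul h1 hy hσ'.le (this.trans h1)

end ExpApprox

open ExpApprox in
theorem corollary2 (s t : ℤ) (hs : 3 ≤ |s|) (ht : 1 ≤ t) (hst : Int.gcd s t = 1)
    (M N : ℤ) (hM : M ≠ 0) (hN : ExpApprox.N2 s t ≤ (N : ℝ)) :
    1 < |Real.exp ((s : ℝ) / t) - (M : ℝ) / N| * ExpApprox.c2 s t
        * (N : ℝ) ^ (2 + 2 * Real.log (|(s : ℝ)| / ExpApprox.alpha s)
            * (1 + ExpApprox.rho s t * ExpApprox.eps N) / Real.log (Real.log N))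
        * (Real.log N / Real.log (Real.log N)) ^ (2 * ExpApprox.beta s + 1) := by
  have hs0 : s ≠ 0 := by rintro rfl; simp at hs
  have hs' : 0 < |(s : ℝ)| := abs_pos.2 (by exact_mod_cast hs0)
  have ht' : (0 : ℝ) < t := by exact_mod_cast ht
  have hα := alpha_pos s
  have hγ := gamma_pos s
  have hσ := sigma_pos hs0 ht
  have hN0 : (0 : ℝ) < N := (Real.exp_pos _).trans_le hN
  have hNZ : 0 < N := by exact_mod_cast hN0
  have hx2 : logN2 s t ≤ Real.log N := (Real.le_log_iff_exp_le hN0).2 hN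
  set x := Real.log N with hx
  -- The five bounds contained in `log N₂ ≤ x`.
  have hx_N1 : logN1 s t ≤ x := (le_max_left _ _).trans hx2
  have hE4 : Real.exp (4 * Real.exp 1) ≤ logN2 s t :=
    (le_max_left _ _).trans (le_max_right _ _)
  have hx4 : Real.exp (4 * Real.exp 1) ≤ x := hE4.trans hx2
  have hxσ : (sigma s t ^ 2)⁻¹ ≤ x :=
    ((le_max_left _ _).trans ((le_max_right _ _).trans (le_max_right _ _))).trans hx2
  have hxβ : (beta s : ℝ) ^ 2 ≤ x :=
    ((le_max_left _ _).trans ((le_max_right _ _).trans ((le_max_right _ _).trans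
      (le_max_right _ _)))).trans hx2
  have hxρ : (rho s t * (2 * beta s + 1) / (2 * Real.log (|(s : ℝ)| / alpha s))) ^ (4 / 3 : ℝ) ≤ x :=
    ((le_max_right _ _).trans ((le_max_right _ _).trans ((le_max_right _ _).trans
      (le_max_right _ _)))).trans hx2
  set u := |(s : ℝ)| / alpha s with hu
  set w := Real.log u with hw
  have hu1 : 3 / 2 ≤ u := by rw [hu, le_div_iff₀ hα]; exact three_halves_mul_alpha_le hs
  have hu0 : 0 < u := by linarith
  have hw0 : 0 < w := Real.log_pos (by linarith)
  have hx0 : 0 < x := (Real.exp_pos _).trans_le hx4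
  have hy := four_exp_one_le_log hx4
  have hy0 : 0 < Real.log x := lt_of_lt_of_le (by positivity) hy
  have hy2 : 0 < Real.log (Real.log x) :=
    lt_of_lt_of_le (by norm_num) (le_log_of_four_exp_one_le hy)
  have hσinv : (sigma s t)⁻¹ ≤ x ^ (1 / 2 : ℝ) := by
    rw [← Real.sqrt_eq_rpow]
    exact Real.le_sqrt_of_sq_le (by rwa [inv_pow])
  have hβ2 : (beta s : ℝ) ≤ x ^ (1 / 2 : ℝ) := by
    rw [← Real.sqrt_eq_rpow]; exact Real.le_sqrt_of_sq_le hxβ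
  -- `a` is the negative part of `log σ`.
  obtain ⟨a, ha0, hax, haσ, hρ⟩ : ∃ a : ℝ, 0 ≤ a ∧ 2 * a ≤ Real.log x ∧
      -Real.log (sigma s t) ≤ a ∧ (a = 0 ∧ rho s t = 7 / 3 ∨ rho s t = 5 + 2 * a) := by
    by_cases h : 1 ≤ sigma s t
    · refine ⟨0, le_rfl, by linarith, ?_, Or.inl ⟨rfl, by simp [rho, h]⟩⟩
      linarith [Real.log_nonneg h]
    · refine ⟨-Real.log (sigma s t), ?_, ?_, le_rfl, Or.inr ?_⟩
      · have := Real.log_nonpos hσ.le (not_le.1 h).le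
        linarith
      · have := Real.log_le_log (by positivity) hxσ
        rw [Real.log_inv, Real.log_pow] at this
        push_cast at this
        linarith
      · rw [rho, if_neg h]; ring
  have hρ0 : 0 < rho s t := by rcases hρ with ⟨_, h⟩ | h <;> rw [h] <;> positivity
  have hβρ : (2 * (beta s : ℝ) + 1) * rho s t ≤ 2 * w * x ^ (3 / 4 : ℝ) := by
    have hb0 : 0 ≤ rho s t * (2 * beta s + 1) / (2 * w) := by positivity
    have h := Real.rpow_le_rpow (Real.rpow_nonneg hb0 _) hxρ (by norm_num : (0 : ℝ) ≤ 3 / 4)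
    rw [← Real.rpow_mul hb0] at h
    norm_num at h
    rw [div_le_iff₀ (by positivity)] at h
    linarith
  obtain ⟨m, hm, hlarge, hsmall⟩ := exists_last_large_remainder hs0 ht hN0
    (commonFactor_one_le hs0 ht hN0 hx_N1)
  have hone := one_lt_of_last_large_remainder (M := M) hs0 ht hNZ hm hlarge hsmall
  have hN1 : (1 : ℝ) ≤ N := by exact_mod_cast hNZ
  have hmY := le_div_of_mul_log_le hx4 ha0 hax hσ haσ
    (fun h => sub_beta_mul_log_le hs0 ht hN1 hx_N1 hm hlarge h)
  have hexp := exponent_le (z := |(s : ℝ) / t|) hx4 ha0 hax hρ hw0 (Nat.cast_nonneg (beta s)) hβ2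
    (abs_div_le hs ht hσinv) hβρ
  set Λ := x / Real.log x with hΛ
  set Y := x / (Real.log x - Real.log (Real.log x) - a) with hY
  have hΛ0 : 0 < Λ := by positivity
  have hΛY : Λ ≤ Y := by
    have := log_le_of_four_exp_one_le hy
    exact div_le_div_of_nonneg_left hx0.le (by linarith) (by linarith)
  set X := Y + (beta s : ℝ) with hX
  have hmX : (m : ℝ) ≤ X := by linarith
  have hX0 : 0 < X := add_pos_of_pos_of_nonneg (hΛ0.trans_le hΛY) (Nat.cast_nonneg _)
  have hL0 : 0 < logN2 s t := (Real.exp_pos _).trans_le hE4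
  have hd0 : 0 < d s t := by
    have : 0 < logN2 s t ^ (1 / 4 : ℝ) / sigma s t := div_pos (Real.rpow_pos_of_pos hL0 _) hσ
    exact inv_pos.2 (by positivity)
  have hdX : 1 ≤ d s t * X := by
    have h1 : logN2 s t ^ (1 / 4 : ℝ) / sigma s t ≤ Y := by
      calc logN2 s t ^ (1 / 4 : ℝ) / sigma s t = logN2 s t ^ (1 / 4 : ℝ) * (sigma s t)⁻¹ :=
            div_eq_mul_inv _ _
        _ ≤ x ^ (1 / 4 : ℝ) * x ^ (1 / 2 : ℝ) := by gcongr
        _ = x ^ (3 / 4 : ℝ) := by rw [← Real.rpow_add hx0]; norm_num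
        _ ≤ Y := (rpow_three_quarters_le_div_log hx4).trans hΛY
    have h2 : 0 < logN2 s t ^ (1 / 4 : ℝ) / sigma s t := div_pos (Real.rpow_pos_of_pos hL0 _) hσ
    have h3 : 0 < logN2 s t ^ (1 / 4 : ℝ) / sigma s t + beta s := by positivity
    rw [d, inv_mul_eq_div, one_le_div h3]
    linarith
  set δ := d s t with hδ
  set b := beta s with hb
  -- Every factor in `m` is increasing, so `m` may be replaced by its upper bound `X ≥ 1 / d`.
  have hK : (4 * (m : ℝ) + 6) * t + (s : ℝ) ^ 2 ≤ X * (4 * t + δ * (6 * t + (s : ℝ) ^ 2)) := by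
    have h1 : (4 * (m : ℝ)) * t ≤ 4 * X * t := by gcongr
    have h2 : 1 * (6 * t + (s : ℝ) ^ 2) ≤ δ * X * (6 * t + (s : ℝ) ^ 2) := by gcongr
    linarith
  have hmm : (((m : ℝ) + 1) * m) ^ b ≤ (X * (1 + δ) * X) ^ b := by
    have : (m : ℝ) + 1 ≤ X * (1 + δ) := by linarith
    gcongr
  have hupow : u ^ (2 * m + 1) ≤ u ^ (2 * b + 1) * Real.exp (2 * Y * w) := by
    have h1 : u ^ (2 * b + 1) * Real.exp (2 * Y * w) = u ^ ((2 * b + 1 : ℕ) + 2 * Y : ℝ) := by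
      rw [Real.rpow_add hu0, Real.rpow_natCast, Real.rpow_def_of_pos hu0 (2 * Y)]
      congr 2; ring
    rw [h1, ← Real.rpow_natCast]
    refine Real.rpow_le_rpow_of_exponent_le (by linarith) ?_
    push_cast
    linarith
  have hfinal : Real.exp |(s : ℝ) / t| * X ^ (2 * b + 1) * Real.exp (2 * Y * w) ≤
      Λ ^ (2 * b + 1) * (N : ℝ) ^ (2 * w * (1 + rho s t * eps N) / Real.log x) := by
    have h1 : X ^ (2 * b + 1) = Λ ^ (2 * b + 1) *
        Real.exp ((2 * b + 1) * Real.log (X / Λ)) := by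
      have e : Real.exp ((2 * b + 1) * Real.log (X / Λ)) = (X / Λ) ^ (2 * b + 1) := by
        rw [← Real.exp_log (pow_pos (div_pos hX0 hΛ0) (2 * b + 1)), Real.log_pow]
        push_cast; rfl
      rw [e, ← mul_pow]
      congr 1
      field_simp
    have h2 : (N : ℝ) ^ (2 * w * (1 + rho s t * eps N) / Real.log x) =
        Real.exp (2 * Λ * (1 + rho s t * (Real.log (Real.log x) / Real.log x)) * w) := by
      rw [Real.rpow_def_of_pos hN0, ← hx, eps, ← hx, hΛ]
      congr 1
      ring
    rw [h1, h2]
    calc Real.exp |(s : ℝ) / t| * (Λ ^ (2 * b + 1) * Real.exp ((2 * b + 1) * Real.log (X / Λ))) *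
          Real.exp (2 * Y * w)
        = Λ ^ (2 * b + 1) *
          Real.exp (|(s : ℝ) / t| + (2 * b + 1) * Real.log (X / Λ) + 2 * Y * w) := by
          rw [Real.exp_add, Real.exp_add]; ring
      _ ≤ _ := by gcongr
  set Δ := |Real.exp ((s : ℝ) / t) - (M : ℝ) / N| with hΔ
  have hΔ0 : 0 ≤ Δ := abs_nonneg _
  set C := 8 * gamma s ^ 2 * |(s : ℝ)| ^ (2 * b + 1) * (1 + δ) ^ b
      * (4 * t + δ * (6 * t + (s : ℝ) ^ 2)) / alpha s ^ (2 * b + 1) with hC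
  have hCc : C ≤ c2 s t := by
    refine le_add_of_nonneg_right ?_
    have h1 : (0 : ℝ) ≤ (s : ℝ) ^ (2 * ((beta s : ℤ) - 1)) := (even_two_mul _).zpow_nonneg _
    have h2 : (0 : ℝ) < alpha s ^ (2 * ((beta s : ℤ) - 1)) := zpow_pos hα _
    positivity
  have hC' : C = 8 * gamma s ^ 2 * u ^ (2 * b + 1) * (1 + δ) ^ b
      * (4 * t + δ * (6 * t + (s : ℝ) ^ 2)) := by
    rw [hC, hu, div_pow]; ring
  have hc2 : 0 ≤ c2 s t := le_trans (by positivity) hCc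
  have hu' : 0 < u ^ (2 * b + 1) := pow_pos hu0 _
  calc 1 < 8 * (N : ℝ) ^ 2 * Δ * gamma s ^ 2 * (((m : ℝ) + 1) * m) ^ b *
        ((4 * m + 6) * t + (s : ℝ) ^ 2) * u ^ (2 * m + 1) * Real.exp |(s : ℝ) / t| := hone
    _ ≤ 8 * (N : ℝ) ^ 2 * Δ * gamma s ^ 2 * (X * (1 + δ) * X) ^ b *
        (X * (4 * t + δ * (6 * t + (s : ℝ) ^ 2))) * (u ^ (2 * b + 1) * Real.exp (2 * Y * w)) *
        Real.exp |(s : ℝ) / t| := by gcongr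
    _ = Δ * C * (N : ℝ) ^ 2 *
        (Real.exp |(s : ℝ) / t| * X ^ (2 * b + 1) * Real.exp (2 * Y * w)) := by
        rw [hC', mul_pow, mul_pow]; ring
    _ ≤ Δ * c2 s t * (N : ℝ) ^ 2 *
        (Λ ^ (2 * b + 1) * (N : ℝ) ^ (2 * w * (1 + rho s t * eps N) / Real.log x)) := by
        gcongr
    _ = _ := by
        rw [Real.rpow_add hN0, Real.rpow_two]; ring
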